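/- Let $N\ge 1$, let $\Omega\subset\mathbb R^N$ be a bounded open set (in particular, any bounded domain with smooth boundary), let $p=q>1$ and let $\alpha,\beta\ge 1$ be real numbers with $\frac{\alpha}{p}+\frac{\beta}{q}=1$. Let $\lambda>0$ and let $(u,v)\in W^{1,p}_0(\Omega)\times W^{1,q}_0(\Omega)$ be a weak solution of the system $$-\Delta_p u=\lambda |u|^{\alpha-1}|v|^{\beta-1}v,\qquad -\Delta_q v=\lambda |u|^{\alpha-1}|v|^{\beta-1}u\quad\text{in }\Omega,\qquad u=v=0\ \text{on }\partial\Omega,$$ that is, $$\int_\Omega |\nabla u|^{p-2}\nabla u\cdot\nabla\phi\,dx+\int_\Omega |\nabla v|^{q-2}\nabla v\cdot\nabla\psi\,dx=\lambda\Big(\int_\Omega |u|^{\alpha-1}|v|^{\beta-1}v\,\phi\,dx+\int_\Omega |u|^{\alpha-1}|v|^{\beta-1}u\,\psi\,dx\Big)$$ for all $(\phi,\psi)\in W^{1,p}_0(\Omega)\times W^{1,q}_0(\Omega)$. Then: 1. $u=v$ almost everywhere in $\Omega$. 2. The common function $u=v$ is a weak solution of the scalar $p$-Laplace eigenvalue equation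 $\operatorname{div}(|\nabla u|^{p-2}\nabla u)+\lambda|u|^{p-2}u=0$ with the same $\lambda$, i.e. $\int_\Omega|\nabla u|^{p-2}\nabla u\cdot\nabla\phi\,dx=\lambda\int_\Omega|u|^{p-2}u\,\phi\,dx$ for all $\phi\in W^{1,p}_0(\Omega)$. 3. If moreover $\lambda=\lambda(p,q)$ is the first eigenvalue of the system, i.e. the least positive parameter for which the system has a weak solution with both components nonzero, then $\lambda$ is the first eigenvalue of the $p$-Laplacian, $$\lambda=\lambda(p)=\min_{w\in W^{1,p}_0(\Omega),\ w\ne 0}\frac{\int_\Omega|\nabla w|^p\,dx}{\int_\Omega|w|^p\,dx},$$ so that $u=v$ solves the scalar equation with $\lambda=\lambda(p)$. -/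

import Mathlib

open MeasureTheory Filter Topology
open scoped ContDiff

/-- `φ ∈ C_c^∞(Ω)`. -/
def IsTestFunction {N : ℕ} (Ω : Set (EuclideanSpace ℝ (Fin N)))
    (φ : EuclideanSpace ℝ (Fin N) → ℝ) : Prop :=
  ContDiff ℝ ∞ φ ∧ HasCompactSupport φ ∧ tsupport φ ⊆ Ω

/-- `u ∈ W^{1,p}(Ω)` (for `1 ≤ p < ∞`), and the vector field `G` is the weak gradient of `u`
(which is unique up to a null set). -/
structure HasSobolevGradient {N : ℕ} (Ω : Set (EuclideanSpace ℝ (Fin N))) (p : ℝ)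
    (u : EuclideanSpace ℝ (Fin N) → ℝ)
    (G : EuclideanSpace ℝ (Fin N) → EuclideanSpace ℝ (Fin N)) : Prop where
  memLp : MemLp u (ENNReal.ofReal p) (volume.restrict Ω)
  memLp_grad : MemLp G (ENNReal.ofReal p) (volume.restrict Ω)
  integral_eq : ∀ φ : EuclideanSpace ℝ (Fin N) → ℝ, IsTestFunction Ω φ →
    ∀ e : EuclideanSpace ℝ (Fin N),
      ∫ x in Ω, u x * fderiv ℝ φ x e = -∫ x in Ω, inner ℝ (G x) e * φ x

/-- `u ∈ W^{1,p}_0(Ω)`, the closure of `C_c^∞(Ω)` in `W^{1,p}(Ω)`, and `G` is the weak gradient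
of `u`. -/
structure HasSobolevGradientZero {N : ℕ} (Ω : Set (EuclideanSpace ℝ (Fin N))) (p : ℝ)
    (u : EuclideanSpace ℝ (Fin N) → ℝ)
    (G : EuclideanSpace ℝ (Fin N) → EuclideanSpace ℝ (Fin N)) : Prop
    extends HasSobolevGradient Ω p u G where
  approx : ∃ φ : ℕ → EuclideanSpace ℝ (Fin N) → ℝ,
    (∀ n, IsTestFunction Ω (φ n)) ∧
    Tendsto (fun n => eLpNorm (fun x => φ n x - u x) (ENNReal.ofReal p) (volume.restrict Ω))
      atTop (𝓝 0) ∧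
    Tendsto (fun n => eLpNorm (fun x => gradient (φ n) x - G x) (ENNReal.ofReal p)
      (volume.restrict Ω)) atTop (𝓝 0)

/-- `(u, v) ∈ W^{1,p}_0(Ω) × W^{1,q}_0(Ω)` is a weak solution of
`-Δ_p u = lam |u|^{α-1} |v|^{β-1} v`, `-Δ_q v = lam |u|^{α-1} |v|^{β-1} u` in `Ω`,
`u = v = 0` on `∂Ω`. Here `U`, `V`, `Φ`, `Ψ` are the weak gradients of `u`, `v`, `φ`, `ψ`. -/
def IsSystemSolution {N : ℕ} (Ω : Set (EuclideanSpace ℝ (Fin N))) (p q α β lam : ℝ)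
    (u v : EuclideanSpace ℝ (Fin N) → ℝ) : Prop :=
  ∃ U V : EuclideanSpace ℝ (Fin N) → EuclideanSpace ℝ (Fin N),
    HasSobolevGradientZero Ω p u U ∧ HasSobolevGradientZero Ω q v V ∧
    ∀ (φ ψ : EuclideanSpace ℝ (Fin N) → ℝ)
      (Φ Ψ : EuclideanSpace ℝ (Fin N) → EuclideanSpace ℝ (Fin N)),
      HasSobolevGradientZero Ω p φ Φ → HasSobolevGradientZero Ω q ψ Ψ →
      (∫ x in Ω, ‖U x‖ ^ (p - 2) * inner ℝ (U x) (Φ x)) +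
          (∫ x in Ω, ‖V x‖ ^ (q - 2) * inner ℝ (V x) (Ψ x)) =
        lam * ((∫ x in Ω, |u x| ^ (α - 1) * |v x| ^ (β - 1) * v x * φ x) +
          ∫ x in Ω, |u x| ^ (α - 1) * |v x| ^ (β - 1) * u x * ψ x)

/-- `u ∈ W^{1,p}_0(Ω)` is a weak solution of `div(|∇u|^{p-2} ∇u) + lam |u|^{p-2} u = 0`
in `Ω`, `u = 0` on `∂Ω`. -/
def IsPLaplaceSolution {N : ℕ} (Ω : Set (EuclideanSpace ℝ (Fin N))) (p lam : ℝ)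
    (u : EuclideanSpace ℝ (Fin N) → ℝ) : Prop :=
  ∃ U : EuclideanSpace ℝ (Fin N) → EuclideanSpace ℝ (Fin N),
    HasSobolevGradientZero Ω p u U ∧
    ∀ (φ : EuclideanSpace ℝ (Fin N) → ℝ)
      (Φ : EuclideanSpace ℝ (Fin N) → EuclideanSpace ℝ (Fin N)),
      HasSobolevGradientZero Ω p φ Φ →
      ∫ x in Ω, ‖U x‖ ^ (p - 2) * inner ℝ (U x) (Φ x) =
        lam * ∫ x in Ω, |u x| ^ (p - 2) * u x * φ x

/-- `lam = λ(p,q)`: the least positive parameter for which the system has a weak solution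
`(u, v)` with `u ≠ 0` and `v ≠ 0`. -/
def IsFirstSystemEigenvalue {N : ℕ} (Ω : Set (EuclideanSpace ℝ (Fin N)))
    (p q α β lam : ℝ) : Prop :=
  IsLeast {μ : ℝ | 0 < μ ∧ ∃ u v : EuclideanSpace ℝ (Fin N) → ℝ,
    IsSystemSolution Ω p q α β μ u v ∧
      ¬ (u =ᵐ[volume.restrict Ω] 0) ∧ ¬ (v =ᵐ[volume.restrict Ω] 0)} lam

/-- `lam = λ(p)`, the minimum of `∫_Ω |∇w|^p / ∫_Ω |w|^p` over the nonzero
`w ∈ W^{1,p}_0(Ω)`. -/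
def IsFirstPLaplaceEigenvalue {N : ℕ} (Ω : Set (EuclideanSpace ℝ (Fin N)))
    (p lam : ℝ) : Prop :=
  IsLeast {r : ℝ | ∃ (w : EuclideanSpace ℝ (Fin N) → ℝ)
    (W : EuclideanSpace ℝ (Fin N) → EuclideanSpace ℝ (Fin N)),
    HasSobolevGradientZero Ω p w W ∧ ¬ (w =ᵐ[volume.restrict Ω] 0) ∧
      r = (∫ x in Ω, ‖W x‖ ^ p) / ∫ x in Ω, |w x| ^ p} lam

/-! Since `p = q`, the exponent condition reads `α + β = p`, which forces `p ≥ 2`. Testing the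
system with `(u - v, v - u)` turns the right side into `-λ ∫ |u|^(α-1) |v|^(β-1) (u - v)² ≤ 0`,
while strict monotonicity of `a ↦ |a|^(p-2) a` makes the left side nonnegative and zero only if `∇u
= ∇v` a.e. Poincaré's inequality then gives `u = v`, and test pairs `(φ, 0)` give the scalar
equation.

Conversely, a scalar solution `w` yields the system solution `(w, w)`, so both problems have the
same eigenvalues. A scalar solution tested with itself shows that `λ` is a Rayleigh quotient. That
no quotient is smaller requires the minimum to be attained by an eigenfunction, to which minimality
of `λ` among system eigenvalues applies.

The minimizer comes from the direct method. Normalized test functions with energies tending to the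
infimum converge strongly in `L^p` along a subsequence
(`exists_subseq_tendsto_of_bounded_gradient`). Their gradients also converge strongly, by a Clarkson
inequality for `p ≥ 2` (`norm_midpoint_rpow_add_le`), so weak lower semicontinuity is not needed.
Differentiating the energy along lines gives the Euler–Lagrange equation. -/

/-! ### Calculus of test functions. -/

section TestFunctions

variable {N : ℕ} {Ω : Set (EuclideanSpace ℝ (Fin N))} {φ ψ : EuclideanSpace ℝ (Fin N) → ℝ}

theorem inner_gradient_eq_fderiv (φ : EuclideanSpace ℝ (Fin N) → ℝ)
    (x e : EuclideanSpace ℝ (Fin N)) : inner ℝ (gradient φ x) e = fderiv ℝ φ x e := by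
  simp [gradient]

namespace IsTestFunction

theorem hasCompactSupport (h : IsTestFunction Ω φ) : HasCompactSupport φ := h.2.1

theorem continuous (h : IsTestFunction Ω φ) : Continuous φ := h.1.continuous

theorem differentiable (h : IsTestFunction Ω φ) : Differentiable ℝ φ :=
  h.1.differentiable (by simp)

theorem continuous_fderiv (h : IsTestFunction Ω φ) : Continuous (fderiv ℝ φ) :=
  h.1.continuous_fderiv (by simp)

theorem continuous_gradient (h : IsTestFunction Ω φ) : Continuous (gradient φ) :=
  (LinearIsometryEquiv.continuous _).comp h.continuous_fderiv

theorem support_subset (h : IsTestFunction Ω φ) : Function.support φ ⊆ Ω :=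
  (subset_tsupport φ).trans h.2.2

theorem support_gradient_subset (h : IsTestFunction Ω φ) :
    Function.support (gradient φ) ⊆ Ω := by
  refine Set.Subset.trans (fun x hx => ?_) ((support_fderiv_subset ℝ).trans h.2.2)
  rw [Function.mem_support] at hx ⊢
  exact fun h0 => hx (by simp [gradient, h0])

theorem hasCompactSupport_gradient (h : IsTestFunction Ω φ) :
    HasCompactSupport (gradient φ) :=
  (h.hasCompactSupport.fderiv ℝ).comp_left (g := (InnerProductSpace.toDual ℝ _).symm) (map_zero _)

theorem memLp (h : IsTestFunction Ω φ) (P : ENNReal) : MemLp φ P volume :=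
  h.continuous.memLp_of_hasCompactSupport h.hasCompactSupport

theorem memLp_gradient (h : IsTestFunction Ω φ) (P : ENNReal) :
    MemLp (gradient φ) P volume :=
  h.continuous_gradient.memLp_of_hasCompactSupport h.hasCompactSupport_gradient

theorem eLpNorm_restrict (h : IsTestFunction Ω φ) (P : ENNReal) :
    eLpNorm φ P (volume.restrict Ω) = eLpNorm φ P volume :=
  eLpNorm_restrict_eq_of_support_subset h.support_subset

theorem eLpNorm_gradient_restrict (h : IsTestFunction Ω φ) (P : ENNReal) :
    eLpNorm (gradient φ) P (volume.restrict Ω) = eLpNorm (gradient φ) P volume :=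
  eLpNorm_restrict_eq_of_support_subset h.support_gradient_subset

theorem gradient_add (h : IsTestFunction Ω φ) (h' : IsTestFunction Ω ψ) :
    gradient (φ + ψ) = gradient φ + gradient ψ := by
  ext1 x
  simp [gradient, fderiv_add (h.differentiable x) (h'.differentiable x)]

theorem gradient_const_smul (h : IsTestFunction Ω φ) (c : ℝ) :
    gradient (c • φ) = c • gradient φ := by
  ext1 x
  simp [gradient, fderiv_const_smul (h.differentiable x) c]

theorem add (h : IsTestFunction Ω φ) (h' : IsTestFunction Ω ψ) : IsTestFunction Ω (φ + ψ) :=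
  ⟨h.1.add h'.1, h.2.1.add h'.2.1,
    (tsupport_add φ ψ).trans (Set.union_subset h.2.2 h'.2.2)⟩

theorem const_smul (h : IsTestFunction Ω φ) (c : ℝ) : IsTestFunction Ω (c • φ) :=
  ⟨h.1.const_smul c, h.2.1.mono (Function.support_const_smul_subset c φ),
    (closure_mono (Function.support_const_smul_subset c φ)).trans h.2.2⟩

theorem setIntegral_mul_fderiv (hφ : IsTestFunction Ω φ) (hψ : IsTestFunction Ω ψ)
    (e : EuclideanSpace ℝ (Fin N)) :
    ∫ x in Ω, φ x * fderiv ℝ ψ x e = -∫ x in Ω, inner ℝ (gradient φ x) e * ψ x := by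
  have hc : Continuous fun x => fderiv ℝ φ x e := hφ.continuous_fderiv.clm_apply continuous_const
  have hc' : Continuous fun x => fderiv ℝ ψ x e := hψ.continuous_fderiv.clm_apply continuous_const
  simp only [inner_gradient_eq_fderiv]
  rw [setIntegral_eq_integral_of_forall_compl_eq_zero, setIntegral_eq_integral_of_forall_compl_eq_zero]
  · refine integral_mul_fderiv_eq_neg_fderiv_mul_of_integrable ?_ ?_ ?_
      (fun x _ => hφ.differentiable x) (fun x _ => hψ.differentiable x)
    · exact (hc.mul hψ.continuous).integrable_of_hasCompactSupport hψ.hasCompactSupport.mul_left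
    · exact (hφ.continuous.mul hc').integrable_of_hasCompactSupport hφ.hasCompactSupport.mul_right
    · exact (hφ.continuous.mul hψ.continuous).integrable_of_hasCompactSupport
        hφ.hasCompactSupport.mul_right
  · intro x hx
    simp [Function.notMem_support.1 (fun h => hx (hψ.support_subset h))]
  · intro x hx
    simp [Function.notMem_support.1 (fun h => hx (hφ.support_subset h))]

end IsTestFunction

end TestFunctions

/-! ### `W^{1,p}_0` as a vector space closed under limits. -/

section Closure

variable {N : ℕ} {Ω : Set (EuclideanSpace ℝ (Fin N))} {p : ℝ}

theorem tendsto_integral_mul_of_tendsto_eLpNorm {α : Type*} [MeasurableSpace α] {μ : Measure α}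
    [IsFiniteMeasure μ] {P : ENNReal} (hP : 1 ≤ P) {f : ℕ → α → ℝ} {f₀ g : α → ℝ}
    (hf : ∀ n, MemLp (f n) P μ) (hf₀ : MemLp f₀ P μ) (hg : MemLp g ⊤ μ)
    (h : Tendsto (fun n => eLpNorm (f n - f₀) P μ) atTop (𝓝 0)) :
    Tendsto (fun n => ∫ x, f n x * g x ∂μ) atTop (𝓝 (∫ x, f₀ x * g x ∂μ)) := by
  have hint : ∀ {k : α → ℝ}, MemLp k P μ → Integrable (fun x => k x * g x) μ := fun hk =>
    (hk.integrable hP).mul_of_top_left hg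
  refine tendsto_integral_of_L1' _ (hint hf₀).1 (Eventually.of_forall fun n => hint (hf n)) ?_
  have hbound : ∀ n, eLpNorm ((fun x => f n x * g x) - fun x => f₀ x * g x) 1 μ ≤
      (eLpNorm (f n - f₀) P μ * μ Set.univ ^ (1 / (1 : ENNReal).toReal - 1 / P.toReal)) *
        eLpNorm g ⊤ μ := by
    intro n
    have h1 : ((fun x => f n x * g x) - fun x => f₀ x * g x) = (f n - f₀) • g := by
      ext x; simp [sub_mul]
    rw [h1]
    refine (eLpNorm_smul_le_mul_eLpNorm (p := 1) (q := ⊤) (r := 1) hg.1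
      ((hf n).1.sub hf₀.1)).trans ?_
    gcongr
    exact eLpNorm_le_eLpNorm_mul_rpow_measure_univ hP ((hf n).1.sub hf₀.1)
  have hC : μ Set.univ ^ (1 / (1 : ENNReal).toReal - 1 / P.toReal) ≠ ⊤ := by
    refine ENNReal.rpow_ne_top_of_nonneg ?_ (measure_ne_top _ _)
    rcases eq_or_ne P ⊤ with rfl | hPt
    · simp
    · have : 1 ≤ P.toReal := by simpa using ENNReal.toReal_mono hPt hP
      simpa using inv_le_one_of_one_le₀ this
  refine tendsto_of_tendsto_of_tendsto_of_le_of_le tendsto_const_nhds ?_ (fun n => zero_le)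
    hbound
  have := ENNReal.Tendsto.mul_const (ENNReal.Tendsto.mul_const h (Or.inr hC))
    (b := eLpNorm g ⊤ μ) (Or.inr hg.2.ne)
  simpa using this

namespace HasSobolevGradientZero

/-- On a bounded set, pairing with a bounded function is continuous in `L^p`, so the weak gradient
identity passes to the limit from test functions. Membership in `W^{1,p}_0` thus reduces to finding
approximants. -/
theorem of_tendsto (hΩb : Bornology.IsBounded Ω) (hp : 1 ≤ p)
    {u : EuclideanSpace ℝ (Fin N) → ℝ}
    {G : EuclideanSpace ℝ (Fin N) → EuclideanSpace ℝ (Fin N)}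
    (hu : MemLp u (ENNReal.ofReal p) (volume.restrict Ω))
    (hG : MemLp G (ENNReal.ofReal p) (volume.restrict Ω))
    {φ : ℕ → EuclideanSpace ℝ (Fin N) → ℝ} (hφ : ∀ n, IsTestFunction Ω (φ n))
    (h : Tendsto (fun n => eLpNorm (φ n - u) (ENNReal.ofReal p) (volume.restrict Ω))
      atTop (𝓝 0))
    (h' : Tendsto (fun n => eLpNorm (gradient (φ n) - G) (ENNReal.ofReal p)
      (volume.restrict Ω)) atTop (𝓝 0)) :
    HasSobolevGradientZero Ω p u G := by
  have hP : 1 ≤ ENNReal.ofReal p := by simpa using ENNReal.ofReal_le_ofReal hp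
  have : IsFiniteMeasure (volume.restrict Ω) :=
    ⟨by simpa using hΩb.measure_lt_top⟩
  refine ⟨⟨hu, hG, fun ψ hψ e => ?_⟩, φ, hφ, h, h'⟩
  have hg1 : MemLp (fun x => fderiv ℝ ψ x e) ⊤ (volume.restrict Ω) :=
    ((hψ.continuous_fderiv.clm_apply continuous_const).memLp_of_hasCompactSupport
      (hψ.hasCompactSupport.fderiv_apply ℝ e)).restrict _
  have hg2 : MemLp ψ ⊤ (volume.restrict Ω) := (hψ.memLp ⊤).restrict _
  have t1 := tendsto_integral_mul_of_tendsto_eLpNorm hP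
    (fun n => ((hφ n).memLp _).restrict Ω) hu hg1 h
  have hin : ∀ n, MemLp (fun x => inner ℝ (gradient (φ n) x) e) (ENNReal.ofReal p)
      (volume.restrict Ω) := fun n => (((hφ n).memLp_gradient _).restrict Ω).inner_const e
  have t2 := tendsto_integral_mul_of_tendsto_eLpNorm hP hin (hG.inner_const e) hg2 (by
    refine tendsto_of_tendsto_of_tendsto_of_le_of_le tendsto_const_nhds
      (h := fun n => ENNReal.ofReal ‖e‖ * eLpNorm (gradient (φ n) - G) (ENNReal.ofReal p)
        (volume.restrict Ω)) ?_ (fun n => zero_le) (fun n => ?_)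
    · simpa using ENNReal.Tendsto.const_mul (a := ENNReal.ofReal ‖e‖) h'
        (Or.inr ENNReal.ofReal_ne_top)
    · refine eLpNorm_le_mul_eLpNorm_of_ae_le_mul (Eventually.of_forall fun x => ?_) _
      simp only [Pi.sub_apply, ← inner_sub_left]
      rw [mul_comm]
      exact norm_inner_le_norm _ _)
  refine tendsto_nhds_unique t1 ?_
  simp only [(hφ _).setIntegral_mul_fderiv hψ e]
  exact t2.neg

theorem of_isTestFunction (hΩb : Bornology.IsBounded Ω) (hp : 1 ≤ p)
    {φ : EuclideanSpace ℝ (Fin N) → ℝ} (hφ : IsTestFunction Ω φ) :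
    HasSobolevGradientZero Ω p φ (gradient φ) :=
  of_tendsto hΩb hp ((hφ.memLp _).restrict Ω) ((hφ.memLp_gradient _).restrict Ω)
    (fun _ : ℕ => hφ) (by simp) (by simp)

variable {u v : EuclideanSpace ℝ (Fin N) → ℝ}
  {U V : EuclideanSpace ℝ (Fin N) → EuclideanSpace ℝ (Fin N)}

theorem add (hΩb : Bornology.IsBounded Ω) (hp : 1 ≤ p) (hu : HasSobolevGradientZero Ω p u U)
    (hv : HasSobolevGradientZero Ω p v V) : HasSobolevGradientZero Ω p (u + v) (U + V) := by
  have hP : 1 ≤ ENNReal.ofReal p := by simpa using ENNReal.ofReal_le_ofReal hp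
  obtain ⟨φ, hφ, h1, h2⟩ := hu.approx
  obtain ⟨ψ, hψ, h3, h4⟩ := hv.approx
  refine of_tendsto hΩb hp (hu.memLp.add hv.memLp) (hu.memLp_grad.add hv.memLp_grad)
    (fun n => (hφ n).add (hψ n)) ?_ ?_
  · refine tendsto_of_tendsto_of_tendsto_of_le_of_le tendsto_const_nhds
      (by simpa using h1.add h3) (fun n => zero_le) (fun n => ?_)
    rw [add_sub_add_comm]
    exact eLpNorm_add_le ((((hφ n).memLp 1).restrict Ω).1.sub hu.memLp.1)
      ((((hψ n).memLp 1).restrict Ω).1.sub hv.memLp.1) hP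
  · refine tendsto_of_tendsto_of_tendsto_of_le_of_le tendsto_const_nhds
      (by simpa using h2.add h4) (fun n => zero_le) (fun n => ?_)
    rw [(hφ n).gradient_add (hψ n), add_sub_add_comm]
    exact eLpNorm_add_le ((((hφ n).memLp_gradient 1).restrict Ω).1.sub hu.memLp_grad.1)
      ((((hψ n).memLp_gradient 1).restrict Ω).1.sub hv.memLp_grad.1) hP

theorem const_smul (hΩb : Bornology.IsBounded Ω) (hp : 1 ≤ p)
    (hu : HasSobolevGradientZero Ω p u U) (c : ℝ) :
    HasSobolevGradientZero Ω p (c • u) (c • U) := by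
  obtain ⟨φ, hφ, h1, h2⟩ := hu.approx
  refine of_tendsto hΩb hp (hu.memLp.const_smul c) (hu.memLp_grad.const_smul c)
    (fun n => (hφ n).const_smul c) ?_ ?_
  · simp only [← smul_sub, eLpNorm_const_smul]
    have := ENNReal.Tendsto.const_mul (a := ‖c‖ₑ) h1 (Or.inr enorm_ne_top)
    rwa [mul_zero] at this
  · simp only [(hφ _).gradient_const_smul, ← smul_sub, eLpNorm_const_smul]
    have := ENNReal.Tendsto.const_mul (a := ‖c‖ₑ) h2 (Or.inr enorm_ne_top)
    rwa [mul_zero] at this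

theorem sub (hΩb : Bornology.IsBounded Ω) (hp : 1 ≤ p) (hu : HasSobolevGradientZero Ω p u U)
    (hv : HasSobolevGradientZero Ω p v V) : HasSobolevGradientZero Ω p (u - v) (U - V) := by
  simpa [sub_eq_add_neg] using hu.add hΩb hp (hv.const_smul hΩb hp (-1))

theorem zero (hΩb : Bornology.IsBounded Ω) (hp : 1 ≤ p) :
    HasSobolevGradientZero Ω p 0 0 :=
  of_tendsto hΩb hp MemLp.zero MemLp.zero (φ := fun _ => 0)
    (fun _ => ⟨contDiff_const, HasCompactSupport.zero, by simp⟩)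
    (by simp) (by
      have : gradient (0 : EuclideanSpace ℝ (Fin N) → ℝ) = 0 := by ext1 x; simp [gradient]
      simp [this])

end HasSobolevGradientZero

end Closure

/-! ### Translation estimates and Poincaré's inequality. -/

section Translation

theorem enorm_integral_rpow_le_lintegral {α F : Type*} [MeasurableSpace α] {μ : Measure α}
    [IsProbabilityMeasure μ] [NormedAddCommGroup F] [NormedSpace ℝ F] {p : ℝ} (hp : 1 ≤ p)
    {f : α → F} (hf : AEStronglyMeasurable f μ) :
    ‖∫ x, f x ∂μ‖ₑ ^ p ≤ ∫⁻ x, ‖f x‖ₑ ^ p ∂μ := by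
  have hp0 : 0 < p := by linarith
  have h1 := eLpNorm'_le_eLpNorm'_of_exponent_le one_pos hp μ hf
  simp only [eLpNorm', ENNReal.rpow_one, div_one] at h1
  calc ‖∫ x, f x ∂μ‖ₑ ^ p ≤ ((∫⁻ x, ‖f x‖ₑ ^ p ∂μ) ^ (1 / p)) ^ p := by
        gcongr
        exact (enorm_integral_le_lintegral_enorm f).trans h1
    _ = ∫⁻ x, ‖f x‖ₑ ^ p ∂μ := by
        rw [← ENNReal.rpow_mul, one_div_mul_cancel hp0.ne', ENNReal.rpow_one]

theorem eLpNorm_ofReal_eq_lintegral {F : Type*} [NormedAddCommGroup F] {α : Type*}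
    [MeasurableSpace α] {μ : Measure α} (hp : 0 < p) (f : α → F) :
    eLpNorm f (ENNReal.ofReal p) μ = (∫⁻ x, ‖f x‖ₑ ^ p ∂μ) ^ (1 / p) := by
  rw [eLpNorm_eq_lintegral_rpow_enorm_toReal (by simpa using hp) ENNReal.ofReal_ne_top,
    ENNReal.toReal_ofReal hp.le]

variable {N : ℕ} {Ω : Set (EuclideanSpace ℝ (Fin N))} {p : ℝ}
  {φ : EuclideanSpace ℝ (Fin N) → ℝ}

namespace IsTestFunction

/-- Write the difference as the integral of the derivative along the segment, apply Jensen on `[0,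
1]`, then Tonelli and translation invariance. -/
theorem lintegral_enorm_sub_translate_le (hφ : IsTestFunction Ω φ) (hp : 1 ≤ p)
    (h : EuclideanSpace ℝ (Fin N)) :
    ∫⁻ x, ‖φ x - φ (x + h)‖ₑ ^ p ≤ ‖h‖ₑ ^ p * ∫⁻ x, ‖gradient φ x‖ₑ ^ p := by
  have hp0 : 0 < p := by linarith
  let ν : Measure ℝ := volume.restrict (Set.Ioc 0 1)
  have : IsProbabilityMeasure ν := ⟨by simp [ν]⟩
  have hcont : Continuous fun z : EuclideanSpace ℝ (Fin N) × ℝ =>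
      fderiv ℝ φ (z.1 + z.2 • h) h :=
    (hφ.continuous_fderiv.comp (by fun_prop)).clm_apply continuous_const
  have hft : ∀ x, φ (x + h) - φ x = ∫ t, fderiv ℝ φ (x + t • h) h ∂ν := by
    intro x
    have hd : ∀ t ∈ Set.uIcc (0 : ℝ) 1,
        HasDerivAt (fun t : ℝ => φ (x + t • h)) (fderiv ℝ φ (x + t • h) h) t := by
      intro t _
      have h1 : HasDerivAt (fun t : ℝ => x + t • h) h t := by
        simpa using ((hasDerivAt_id t).smul_const h).const_add x
      exact (hφ.differentiable _).hasFDerivAt.comp_hasDerivAt t h1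
    have := intervalIntegral.integral_eq_sub_of_hasDerivAt hd
      ((hcont.comp (Continuous.prodMk_right x)).intervalIntegrable 0 1)
    rw [intervalIntegral.integral_of_le zero_le_one] at this
    simpa using this.symm
  have hpt : ∀ x, ‖φ x - φ (x + h)‖ₑ ^ p ≤
      ∫⁻ t, ‖h‖ₑ ^ p * ‖gradient φ (x + t • h)‖ₑ ^ p ∂ν := by
    intro x
    rw [← enorm_neg, neg_sub, hft x]
    refine (enorm_integral_rpow_le_lintegral hp
      (hcont.comp (Continuous.prodMk_right x)).aestronglyMeasurable).trans ?_
    refine lintegral_mono fun t => ?_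
    simp only [Function.comp_apply]
    rw [← ENNReal.mul_rpow_of_nonneg _ _ hp0.le]
    gcongr
    rw [← inner_gradient_eq_fderiv, mul_comm, ← ofReal_norm, ← ofReal_norm, ← ofReal_norm,
      ← ENNReal.ofReal_mul (norm_nonneg _)]
    exact ENNReal.ofReal_le_ofReal (norm_inner_le_norm _ _)
  calc ∫⁻ x, ‖φ x - φ (x + h)‖ₑ ^ p
      ≤ ∫⁻ x, ∫⁻ t, ‖h‖ₑ ^ p * ‖gradient φ (x + t • h)‖ₑ ^ p ∂ν := lintegral_mono hpt
    _ = ∫⁻ t, ∫⁻ x, ‖h‖ₑ ^ p * ‖gradient φ (x + t • h)‖ₑ ^ p ∂volume ∂ν := by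
        refine lintegral_lintegral_swap (Measurable.aemeasurable ?_)
        have hg : Continuous fun z : EuclideanSpace ℝ (Fin N) × ℝ =>
          gradient φ (z.1 + z.2 • h) := hφ.continuous_gradient.comp (by fun_prop)
        exact (hg.measurable.enorm.pow_const p).const_mul _
    _ = ∫⁻ _, ‖h‖ₑ ^ p * ∫⁻ x, ‖gradient φ x‖ₑ ^ p ∂volume ∂ν := by
        refine lintegral_congr fun t => ?_
        rw [lintegral_add_right_eq_self (fun x => ‖h‖ₑ ^ p * ‖gradient φ x‖ₑ ^ p) (t • h)]
        exact lintegral_const_mul _ (hφ.continuous_gradient.measurable.enorm.pow_const p)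
    _ = ‖h‖ₑ ^ p * ∫⁻ x, ‖gradient φ x‖ₑ ^ p := by simp

/-- Averaging over shifts of size at most `r` costs `r` times the gradient norm, by Jensen in the
shift. With `r` small this gives the uniform approximation behind Rellich–Kondrachov. -/
theorem eLpNorm_sub_average_le (hφ : IsTestFunction Ω φ) (hp : 1 ≤ p)
    {ν : Measure (EuclideanSpace ℝ (Fin N))} [IsProbabilityMeasure ν] {r : ℝ}
    (hν : ∀ᵐ h ∂ν, ‖h‖ ≤ r) :
    eLpNorm (fun x => φ x - ∫ h, φ (x + h) ∂ν) (ENNReal.ofReal p) volume ≤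
      ENNReal.ofReal r * eLpNorm (gradient φ) (ENNReal.ofReal p) volume := by
  have hp0 : 0 < p := by linarith
  obtain ⟨M, hM⟩ := hφ.hasCompactSupport.exists_bound_of_continuous hφ.continuous
  have hpt : ∀ x, ‖φ x - ∫ h, φ (x + h) ∂ν‖ₑ ^ p ≤ ∫⁻ h, ‖φ x - φ (x + h)‖ₑ ^ p ∂ν := by
    intro x
    have hc : Continuous fun h => φ (x + h) := hφ.continuous.comp (by fun_prop)
    have hi : Integrable (fun h => φ (x + h)) ν :=
      Integrable.of_bound hc.aestronglyMeasurable M (Eventually.of_forall fun h => hM _)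
    have : φ x - ∫ h, φ (x + h) ∂ν = ∫ h, (φ x - φ (x + h)) ∂ν := by
      rw [integral_sub (integrable_const _) hi]; simp
    rw [this]
    exact enorm_integral_rpow_le_lintegral hp (continuous_const.sub hc).aestronglyMeasurable
  have hmeas : Measurable fun z : EuclideanSpace ℝ (Fin N) × EuclideanSpace ℝ (Fin N) =>
      ‖φ z.1 - φ (z.1 + z.2)‖ₑ ^ p := by
    have hc : Continuous fun z : EuclideanSpace ℝ (Fin N) × EuclideanSpace ℝ (Fin N) =>
      φ z.1 - φ (z.1 + z.2) :=
      (hφ.continuous.comp continuous_fst).sub (hφ.continuous.comp (by fun_prop))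
    exact hc.measurable.enorm.pow_const p
  have key : ∫⁻ x, ‖φ x - ∫ h, φ (x + h) ∂ν‖ₑ ^ p ≤
      ENNReal.ofReal r ^ p * ∫⁻ x, ‖gradient φ x‖ₑ ^ p :=
    calc ∫⁻ x, ‖φ x - ∫ h, φ (x + h) ∂ν‖ₑ ^ p
        ≤ ∫⁻ x, ∫⁻ h, ‖φ x - φ (x + h)‖ₑ ^ p ∂ν := lintegral_mono hpt
      _ = ∫⁻ h, ∫⁻ x, ‖φ x - φ (x + h)‖ₑ ^ p ∂volume ∂ν :=
          lintegral_lintegral_swap hmeas.aemeasurable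
      _ ≤ ∫⁻ _, ENNReal.ofReal r ^ p * ∫⁻ x, ‖gradient φ x‖ₑ ^ p ∂volume ∂ν := by
          refine lintegral_mono_ae (hν.mono fun h hh => ?_)
          refine (hφ.lintegral_enorm_sub_translate_le hp h).trans ?_
          gcongr
          rw [← ofReal_norm]
          exact ENNReal.ofReal_le_ofReal hh
      _ = _ := by simp
  rw [eLpNorm_ofReal_eq_lintegral hp0, eLpNorm_ofReal_eq_lintegral hp0]
  calc _ ≤ (ENNReal.ofReal r ^ p * ∫⁻ x, ‖gradient φ x‖ₑ ^ p) ^ (1 / p) := by gcongr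
    _ = _ := by
      rw [ENNReal.mul_rpow_of_nonneg _ _ (by positivity), ← ENNReal.rpow_mul,
        mul_one_div_cancel hp0.ne', ENNReal.rpow_one]

end IsTestFunction

theorem exists_poincare_const (hN : 0 < N) (hΩb : Bornology.IsBounded Ω) (hp : 1 ≤ p) :
    ∃ C : NNReal, ∀ φ : EuclideanSpace ℝ (Fin N) → ℝ, IsTestFunction Ω φ →
      eLpNorm φ (ENNReal.ofReal p) (volume.restrict Ω) ≤
        C * eLpNorm (gradient φ) (ENNReal.ofReal p) (volume.restrict Ω) := by
  have hp0 : 0 < p := by linarith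
  obtain ⟨R, hR0, hR⟩ := hΩb.exists_pos_norm_le
  -- A shift of length `3R` exceeds the diameter bound `2R`, so `φ (x + h) = 0` wherever `φ x ≠ 0`,
  -- and the translation estimate bounds `φ` itself.
  let h : EuclideanSpace ℝ (Fin N) := EuclideanSpace.single ⟨0, hN⟩ (3 * R)
  have hh : ‖h‖ = 3 * R := by simp [h, abs_of_pos hR0]
  refine ⟨‖h‖₊, fun φ hφ => ?_⟩
  rw [hφ.eLpNorm_restrict, hφ.eLpNorm_gradient_restrict, eLpNorm_ofReal_eq_lintegral hp0,
    eLpNorm_ofReal_eq_lintegral hp0]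
  have key : ∫⁻ x, ‖φ x‖ₑ ^ p ≤ ‖h‖ₑ ^ p * ∫⁻ x, ‖gradient φ x‖ₑ ^ p := by
    refine le_trans (lintegral_mono fun x => ?_) (hφ.lintegral_enorm_sub_translate_le hp h)
    by_cases hx : φ x = 0
    · simp [hx, hp0]
    have hxh : φ (x + h) = 0 := by
      refine Function.notMem_support.1 fun hs => ?_
      have h1 := hR _ (hφ.support_subset hs)
      have h2 := hR _ (hφ.support_subset hx)
      have h3 : ‖h‖ ≤ ‖x + h‖ + ‖x‖ := by simpa using norm_sub_le (x + h) x
      linarith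
    simp [hxh]
  calc _ ≤ (‖h‖ₑ ^ p * ∫⁻ x, ‖gradient φ x‖ₑ ^ p) ^ (1 / p) := by gcongr
    _ = _ := by
      rw [ENNReal.mul_rpow_of_nonneg _ _ (by positivity), ← ENNReal.rpow_mul,
        mul_one_div_cancel hp0.ne', ENNReal.rpow_one]
      rfl

theorem HasSobolevGradientZero.ae_eq_zero_of_gradient (hN : 0 < N) (hΩb : Bornology.IsBounded Ω)
    (hp : 1 ≤ p) {G : EuclideanSpace ℝ (Fin N) → EuclideanSpace ℝ (Fin N)}
    (h : HasSobolevGradientZero Ω p φ G) (hG : G =ᵐ[volume.restrict Ω] 0) :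
    φ =ᵐ[volume.restrict Ω] 0 := by
  have hP : 1 ≤ ENNReal.ofReal p := by simpa using ENNReal.ofReal_le_ofReal hp
  have hP0 : ENNReal.ofReal p ≠ 0 := (one_pos.trans_le hP).ne'
  obtain ⟨C, hC⟩ := exists_poincare_const hN hΩb hp
  obtain ⟨ψ, hψ, h1, h2⟩ := h.approx
  have h3 : ∀ n, eLpNorm (fun x => gradient (ψ n) x - G x) (ENNReal.ofReal p)
      (volume.restrict Ω) = eLpNorm (gradient (ψ n)) (ENNReal.ofReal p) (volume.restrict Ω) :=
    fun n => eLpNorm_congr_ae (hG.mono fun x hx => by simp [hx])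
  simp only [h3] at h2
  rw [← eLpNorm_eq_zero_iff h.memLp.1 hP0, ← nonpos_iff_eq_zero]
  refine ge_of_tendsto' (x := atTop) (f := fun n =>
    eLpNorm (fun x => ψ n x - φ x) (ENNReal.ofReal p) (volume.restrict Ω) +
      C * eLpNorm (gradient (ψ n)) (ENNReal.ofReal p) (volume.restrict Ω)) ?_ fun n => ?_
  · simpa using h1.add (ENNReal.Tendsto.const_mul h2 (Or.inr ENNReal.coe_ne_top))
  · have hm : AEStronglyMeasurable (ψ n) (volume.restrict Ω) :=
      (hψ n).continuous.aestronglyMeasurable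
    calc eLpNorm φ (ENNReal.ofReal p) (volume.restrict Ω)
        = eLpNorm ((φ - ψ n) + ψ n) (ENNReal.ofReal p) (volume.restrict Ω) := by simp
      _ ≤ _ := eLpNorm_add_le (h.memLp.1.sub hm) hm hP
      _ ≤ _ := by
        rw [eLpNorm_sub_comm]
        gcongr
        · exact le_rfl
        · exact hC _ (hψ n)

end Translation

/-! ### Strict monotonicity of `a ↦ |a|^(p-2) a` for `p ≥ 2`. -/

section Monotone

variable {F : Type*} [NormedAddCommGroup F] [InnerProductSpace ℝ F] {p : ℝ}

theorem rpow_sub_two_mul_sq {p : ℝ} (hp : 0 < p) {x : ℝ} (hx : 0 ≤ x) :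
    x ^ (p - 2) * x ^ 2 = x ^ p := by
  rcases hx.eq_or_lt with rfl | hx
  · simp [Real.zero_rpow hp.ne']
  · rw [← Real.rpow_natCast x 2, ← Real.rpow_add hx]
    norm_num

/-- Polarization eliminates the inner product of `a` and `b`. For `p ≥ 2` both summands on the right
are nonnegative, and the first controls `a - b`. -/
theorem norm_rpow_mul_inner_sub_add_eq (p : ℝ) (a b : F) :
    ‖a‖ ^ (p - 2) * inner ℝ a (a - b) + ‖b‖ ^ (p - 2) * inner ℝ b (b - a) =
      (‖a‖ ^ (p - 2) + ‖b‖ ^ (p - 2)) / 2 * ‖a - b‖ ^ 2 +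
        (‖a‖ ^ (p - 2) - ‖b‖ ^ (p - 2)) / 2 * (‖a‖ ^ 2 - ‖b‖ ^ 2) := by
  have h := norm_sub_sq_real a b
  rw [h, inner_sub_right, inner_sub_right, real_inner_self_eq_norm_sq,
    real_inner_self_eq_norm_sq, real_inner_comm a b]
  ring

theorem rpow_sub_mul_sq_sub_nonneg {p : ℝ} (hp : 2 ≤ p) {x y : ℝ} (hx : 0 ≤ x) (hy : 0 ≤ y) :
    0 ≤ (x ^ (p - 2) - y ^ (p - 2)) / 2 * (x ^ 2 - y ^ 2) := by
  rcases le_total x y with h | h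
  · have h1 := Real.rpow_le_rpow hx h (sub_nonneg.2 hp)
    have h2 := pow_le_pow_left₀ hx h 2
    nlinarith
  · have h1 := Real.rpow_le_rpow hy h (sub_nonneg.2 hp)
    have h2 := pow_le_pow_left₀ hy h 2
    nlinarith

theorem norm_rpow_mul_inner_sub_nonneg (hp : 2 ≤ p) (a b : F) :
    0 ≤ ‖a‖ ^ (p - 2) * inner ℝ a (a - b) + ‖b‖ ^ (p - 2) * inner ℝ b (b - a) := by
  rw [norm_rpow_mul_inner_sub_add_eq]
  have := rpow_sub_mul_sq_sub_nonneg hp (norm_nonneg a) (norm_nonneg b)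
  positivity

theorem eq_of_norm_rpow_mul_inner_sub_eq_zero (hp : 2 ≤ p) {a b : F}
    (h : ‖a‖ ^ (p - 2) * inner ℝ a (a - b) + ‖b‖ ^ (p - 2) * inner ℝ b (b - a) = 0) :
    a = b := by
  rw [norm_rpow_mul_inner_sub_add_eq] at h
  have h1 := rpow_sub_mul_sq_sub_nonneg hp (norm_nonneg a) (norm_nonneg b)
  by_contra hab
  have h2 : 0 < ‖a - b‖ ^ 2 := by
    have := norm_pos_iff.2 (sub_ne_zero.2 hab)
    positivity
  have ha : 0 ≤ ‖a‖ ^ (p - 2) := by positivity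
  have hb : 0 ≤ ‖b‖ ^ (p - 2) := by positivity
  have h3 : ‖a‖ ^ (p - 2) + ‖b‖ ^ (p - 2) = 0 := by
    have h4 : (‖a‖ ^ (p - 2) + ‖b‖ ^ (p - 2)) / 2 * ‖a - b‖ ^ 2 = 0 :=
      le_antisymm (by linarith) (by positivity)
    rcases mul_eq_zero.1 h4 with h5 | h5
    · linarith
    · exact absurd h5 h2.ne'
  -- A vanishing power forces a zero base. For `p = 2` the convention `0 ^ 0 = 1` already
  -- contradicts `h3`.
  have ha0 := ((Real.rpow_eq_zero_iff_of_nonneg (norm_nonneg a)).1 (by linarith)).1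
  have hb0 := ((Real.rpow_eq_zero_iff_of_nonneg (norm_nonneg b)).1 (by linarith)).1
  exact hab (by rw [norm_eq_zero.1 ha0, norm_eq_zero.1 hb0])

end Monotone

/-! ### Integrability of the terms in the weak formulations. -/

section Integrability

variable {X : Type*} [MeasurableSpace X] {μ : Measure X} {p : ℝ}

theorem MeasureTheory.MemLp.integrable_norm_rpow_of_ofReal {F : Type*} [NormedAddCommGroup F]
    {f : X → F} (hp : 0 < p) (hf : MemLp f (ENNReal.ofReal p) μ) :
    Integrable (fun x => ‖f x‖ ^ p) μ := by
  simpa [ENNReal.toReal_ofReal hp.le] using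
    hf.integrable_norm_rpow (by simpa using hp) ENNReal.ofReal_ne_top

/-- Takes the place of Hölder and Young: a product of total degree `p` is at most the `p`-th power
of the largest base, hence at most the sum of the `p`-th powers. -/
theorem rpow_mul_rpow_mul_mul_le {s t a b c d M : ℝ} (hs : 0 ≤ s) (ht : 0 ≤ t) (ha : 0 ≤ a)
    (hb : 0 ≤ b) (hc : 0 ≤ c) (hd : 0 ≤ d) (haM : a ≤ M) (hbM : b ≤ M) (hcM : c ≤ M)
    (hdM : d ≤ M) : a ^ s * b ^ t * c * d ≤ M ^ (s + t + 2) := by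
  have hM : 0 ≤ M := ha.trans haM
  calc a ^ s * b ^ t * c * d ≤ M ^ s * M ^ t * M * M := by gcongr
    _ = M ^ (s + t + 2) := by
      rw [Real.rpow_add_of_nonneg hM (by positivity) (by norm_num),
        Real.rpow_add_of_nonneg hM hs ht, Real.rpow_two]
      ring

theorem max_rpow_le_add {a b d : ℝ} (ha : 0 ≤ a) (hb : 0 ≤ b) (hd : 0 ≤ d) :
    (max (max a b) d) ^ p ≤ a ^ p + b ^ p + d ^ p := by
  have h1 : 0 ≤ a ^ p := by positivity
  have h2 : 0 ≤ b ^ p := by positivity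
  have h3 : 0 ≤ d ^ p := by positivity
  rcases max_choice (max a b) d with h | h <;> rw [h]
  · rcases max_choice a b with h | h <;> rw [h] <;> linarith
  · linarith

theorem norm_rpow_sub_two_mul_inner_le {F : Type*} [NormedAddCommGroup F] [InnerProductSpace ℝ F]
    (hp : 2 ≤ p) (a b : F) : ‖‖a‖ ^ (p - 2) * inner ℝ a b‖ ≤ ‖a‖ ^ p + ‖b‖ ^ p := by
  -- The dummy factor `‖a‖ ^ 0` brings the product into the four-factor shape of the previous bound.
  have h1 : ‖‖a‖ ^ (p - 2) * inner ℝ a b‖ ≤ ‖a‖ ^ (p - 2) * ‖a‖ ^ (0 : ℝ) * ‖a‖ * ‖b‖ := by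
    rw [norm_mul, Real.norm_of_nonneg (by positivity), Real.rpow_zero, mul_one, mul_assoc]
    gcongr
    exact norm_inner_le_norm _ _
  refine h1.trans ((rpow_mul_rpow_mul_mul_le (M := max ‖a‖ ‖b‖) (by linarith) le_rfl
    (norm_nonneg _) (norm_nonneg _) (norm_nonneg _) (norm_nonneg _) (le_max_left _ _)
    (le_max_left _ _) (le_max_left _ _) (le_max_right _ _)).trans ?_)
  rw [show p - 2 + 0 + 2 = p by ring]
  have h2 : 0 ≤ ‖a‖ ^ p := by positivity
  have h3 : 0 ≤ ‖b‖ ^ p := by positivity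
  rcases max_choice ‖a‖ ‖b‖ with h | h <;> rw [h] <;> linarith

theorem integrable_norm_rpow_mul_inner {F : Type*} [NormedAddCommGroup F] [InnerProductSpace ℝ F]
    (hp : 2 ≤ p) {f g : X → F} (hf : MemLp f (ENNReal.ofReal p) μ)
    (hg : MemLp g (ENNReal.ofReal p) μ) :
    Integrable (fun x => ‖f x‖ ^ (p - 2) * inner ℝ (f x) (g x)) μ := by
  refine Integrable.mono' ((hf.integrable_norm_rpow_of_ofReal (by linarith)).add
    (hg.integrable_norm_rpow_of_ofReal (by linarith))) ?_
    (Eventually.of_forall fun x => norm_rpow_sub_two_mul_inner_le hp _ _)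
  exact ((Real.continuous_rpow_const (by linarith)).comp_aestronglyMeasurable hf.1.norm).mul
    (hf.1.inner hg.1)

theorem integrable_abs_rpow_mul_abs_rpow_mul {α β : ℝ} (hα : 1 ≤ α) (hβ : 1 ≤ β)
    (hαβ : α + β = p) {u v w φ : X → ℝ} (hu : MemLp u (ENNReal.ofReal p) μ)
    (hv : MemLp v (ENNReal.ofReal p) μ) (hw : AEStronglyMeasurable w μ)
    (hwuv : ∀ x, |w x| ≤ max |u x| |v x|) (hφ : MemLp φ (ENNReal.ofReal p) μ) :
    Integrable (fun x => |u x| ^ (α - 1) * |v x| ^ (β - 1) * w x * φ x) μ := by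
  have hp : 0 < p := by linarith
  refine Integrable.mono' (((hu.integrable_norm_rpow_of_ofReal hp).add
    (hv.integrable_norm_rpow_of_ofReal hp)).add (hφ.integrable_norm_rpow_of_ofReal hp)) ?_
    (Eventually.of_forall fun x => ?_)
  · exact ((((Real.continuous_rpow_const (by linarith)).comp_aestronglyMeasurable hu.1.norm).mul
      ((Real.continuous_rpow_const (by linarith)).comp_aestronglyMeasurable hv.1.norm)).mul
      hw).mul hφ.1
  · have h1 : ‖|u x| ^ (α - 1) * |v x| ^ (β - 1) * w x * φ x‖ =
        |u x| ^ (α - 1) * |v x| ^ (β - 1) * |w x| * |φ x| := by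
      rw [norm_mul, norm_mul, Real.norm_of_nonneg (by positivity), Real.norm_eq_abs,
        Real.norm_eq_abs]
    rw [h1]
    refine (rpow_mul_rpow_mul_mul_le (M := max (max |u x| |v x|) |φ x|) (by linarith)
      (by linarith) (abs_nonneg _) (abs_nonneg _) (abs_nonneg _) (abs_nonneg _)
      ((le_max_left _ _).trans (le_max_left _ _)) ((le_max_right _ _).trans (le_max_left _ _))
      ((hwuv x).trans (le_max_left _ _)) (le_max_right _ _)).trans ?_
    rw [show α - 1 + (β - 1) + 2 = p by linarith]
    exact max_rpow_le_add (abs_nonneg _) (abs_nonneg _) (abs_nonneg _)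

theorem abs_rpow_mul_abs_rpow_mul_self {α β p : ℝ} (hαβ : α + β = p) (a : ℝ) :
    |a| ^ (α - 1) * |a| ^ (β - 1) * a = |a| ^ (p - 2) * a := by
  rcases eq_or_ne a 0 with rfl | ha
  · simp
  · rw [← Real.rpow_add (abs_pos.2 ha)]
    congr 2
    linarith

end Integrability

/-! ### Comparison of the system with the scalar equation. -/

section System

variable {N : ℕ} {Ω : Set (EuclideanSpace ℝ (Fin N))} {p α β lam : ℝ}
  {u v : EuclideanSpace ℝ (Fin N) → ℝ}

theorem IsSystemSolution.ae_eq (hN : 0 < N) (hΩb : Bornology.IsBounded Ω) (hα : 1 ≤ α)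
    (hβ : 1 ≤ β) (hαβ : α + β = p) (hlam : 0 ≤ lam)
    (huv : IsSystemSolution Ω p p α β lam u v) : u =ᵐ[volume.restrict Ω] v := by
  have hp : 2 ≤ p := by linarith
  have hp1 : 1 ≤ p := by linarith
  obtain ⟨U, V, hU, hV, h⟩ := huv
  have hD := hU.sub hΩb hp1 hV
  have hD' := hV.sub hΩb hp1 hU
  -- The decisive test pair `(u - v, v - u)`.
  have h0 := h _ _ _ _ hD hD'
  rw [← integral_add (integrable_norm_rpow_mul_inner hp hU.memLp_grad hD.memLp_grad)
      (integrable_norm_rpow_mul_inner hp hV.memLp_grad hD'.memLp_grad),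
    ← integral_add (integrable_abs_rpow_mul_abs_rpow_mul hα hβ hαβ hU.memLp hV.memLp hV.memLp.1
      (fun x => le_max_right _ _) hD.memLp)
      (integrable_abs_rpow_mul_abs_rpow_mul hα hβ hαβ hU.memLp hV.memLp hU.memLp.1
      (fun x => le_max_left _ _) hD'.memLp)] at h0
  have hint := (integrable_norm_rpow_mul_inner hp hU.memLp_grad hD.memLp_grad).add
      (integrable_norm_rpow_mul_inner hp hV.memLp_grad hD'.memLp_grad)
  have hnn : 0 ≤ fun x => ‖U x‖ ^ (p - 2) * inner ℝ (U x) ((U - V) x) +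
      ‖V x‖ ^ (p - 2) * inner ℝ (V x) ((V - U) x) :=
    fun x => norm_rpow_mul_inner_sub_nonneg hp _ _
  have hle : ∫ x in Ω, (|u x| ^ (α - 1) * |v x| ^ (β - 1) * v x * (u - v) x +
      |u x| ^ (α - 1) * |v x| ^ (β - 1) * u x * (v - u) x) ≤ 0 := by
    refine integral_nonpos fun x => ?_
    have : |u x| ^ (α - 1) * |v x| ^ (β - 1) * v x * (u - v) x +
      |u x| ^ (α - 1) * |v x| ^ (β - 1) * u x * (v - u) x =
      -(|u x| ^ (α - 1) * |v x| ^ (β - 1) * (u x - v x) ^ 2) := by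
      simp only [Pi.sub_apply]; ring
    simp only [this, Pi.zero_apply, Left.neg_nonpos_iff]
    positivity
  have hzero := le_antisymm (h0.trans_le (mul_nonpos_of_nonneg_of_nonpos hlam hle))
    (integral_nonneg hnn)
  have hae := (integral_eq_zero_iff_of_nonneg hnn hint).1 hzero
  have := hD.ae_eq_zero_of_gradient hN hΩb hp1 (hae.mono fun x hx => by
    simpa using sub_eq_zero.2 (eq_of_norm_rpow_mul_inner_sub_eq_zero hp hx))
  exact this.mono fun x hx => sub_eq_zero.1 (by simpa using hx)

theorem IsSystemSolution.isPLaplaceSolution (hN : 0 < N) (hΩb : Bornology.IsBounded Ω)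
    (hα : 1 ≤ α) (hβ : 1 ≤ β) (hαβ : α + β = p) (hlam : 0 ≤ lam)
    (huv : IsSystemSolution Ω p p α β lam u v) : IsPLaplaceSolution Ω p lam u := by
  have hae := huv.ae_eq hN hΩb hα hβ hαβ hlam
  obtain ⟨U, V, hU, hV, h⟩ := huv
  refine ⟨U, hU, fun φ Φ hΦ => ?_⟩
  have h0 := h _ _ _ _ hΦ (HasSobolevGradientZero.zero hΩb (by linarith))
  simp only [Pi.zero_apply, inner_zero_right, mul_zero, integral_zero, add_zero] at h0
  rw [h0]
  congr 1
  refine integral_congr_ae (hae.mono fun x hx => ?_)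
  simp only [← hx, abs_rpow_mul_abs_rpow_mul_self hαβ]

/-- On the diagonal both right sides collapse to `|u|^(p-2) u`. This makes scalar eigenvalues
accessible to the minimality of the first system eigenvalue. -/
theorem IsPLaplaceSolution.isSystemSolution (hαβ : α + β = p)
    (hu : IsPLaplaceSolution Ω p lam u) : IsSystemSolution Ω p p α β lam u u := by
  obtain ⟨U, hU, h⟩ := hu
  refine ⟨U, U, hU, hU, fun φ ψ Φ Ψ hΦ hΨ => ?_⟩
  simp only [abs_rpow_mul_abs_rpow_mul_self hαβ]
  rw [h _ _ hΦ, h _ _ hΨ, mul_add]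

theorem IsPLaplaceSolution.exists_gradient_integral_eq (hp : 0 < p)
    (hu : IsPLaplaceSolution Ω p lam u) :
    ∃ U, HasSobolevGradientZero Ω p u U ∧
      ∫ x in Ω, ‖U x‖ ^ p = lam * ∫ x in Ω, |u x| ^ p := by
  obtain ⟨U, hU, h⟩ := hu
  refine ⟨U, hU, ?_⟩
  have h0 := h _ _ hU
  simp only [real_inner_self_eq_norm_sq, rpow_sub_two_mul_sq hp (norm_nonneg _)] at h0
  rw [h0]
  congr 2
  ext x
  rw [mul_assoc, ← sq, ← sq_abs, rpow_sub_two_mul_sq hp (abs_nonneg _)]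

end System

/-! ### Differentiability and uniform convexity of `∫ |f|^p`. -/

section NormPow

variable {X : Type*} [MeasurableSpace X] {μ : Measure X} {F : Type*} [NormedAddCommGroup F]
  [InnerProductSpace ℝ F] {p : ℝ}

theorem hasDerivAt_integral_norm_add_smul_rpow (hp : 2 ≤ p) {f g : X → F}
    (hf : MemLp f (ENNReal.ofReal p) μ) (hg : MemLp g (ENNReal.ofReal p) μ) :
    HasDerivAt (fun t : ℝ => ∫ x, ‖f x + t • g x‖ ^ p ∂μ)
      (p * ∫ x, ‖f x‖ ^ (p - 2) * inner ℝ (f x) (g x) ∂μ) 0 := by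
  have hp0 : 0 < p := by linarith
  have hfg : ∀ t : ℝ, MemLp (fun x => f x + t • g x) (ENNReal.ofReal p) μ :=
    fun t => hf.add (hg.const_smul t)
  have key := hasDerivAt_integral_of_dominated_loc_of_deriv_le (μ := μ) (x₀ := (0 : ℝ))
    (F := fun t x => ‖f x + t • g x‖ ^ p)
    (F' := fun t x => p * (‖f x + t • g x‖ ^ (p - 2) * inner ℝ (f x + t • g x) (g x)))
    -- For `|t| < 1` one has `‖f x + t • g x‖ ≤ ‖f x‖ + ‖g x‖`, which gives an integrable majorant
    -- independent of `t`.
    (bound := fun x => p * (‖‖f x‖ + ‖g x‖‖ ^ p + ‖g x‖ ^ p))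
    (Metric.ball_mem_nhds 0 one_pos)
    (Eventually.of_forall fun t => ((hfg t).integrable_norm_rpow_of_ofReal hp0).1)
    ((hfg 0).integrable_norm_rpow_of_ofReal hp0)
    ((integrable_norm_rpow_mul_inner hp (hfg 0) hg).1.const_mul p)
    (Eventually.of_forall fun x t ht => ?_)
    ((((hf.norm.add hg.norm).integrable_norm_rpow_of_ofReal hp0).add
      (hg.integrable_norm_rpow_of_ofReal hp0)).const_mul p)
    (Eventually.of_forall fun x t _ => ?_)
  · have := key.2
    simp only [zero_smul, add_zero] at this
    rwa [integral_const_mul] at this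
  · rw [norm_mul, Real.norm_of_nonneg hp0.le]
    gcongr
    refine (norm_rpow_sub_two_mul_inner_le hp _ _).trans ?_
    have ht1 : |t| ≤ 1 := by simpa using (Metric.mem_ball.1 ht).le
    gcongr
    rw [Real.norm_of_nonneg (by positivity)]
    refine (norm_add_le _ _).trans ?_
    gcongr
    rw [norm_smul]
    exact mul_le_of_le_one_left (norm_nonneg _) ht1
  · have h1 : HasDerivAt (fun t : ℝ => f x + t • g x) (g x) t := by
      simpa using ((hasDerivAt_id t).smul_const (g x)).const_add (f x)
    have h2 := (hasFDerivAt_norm_rpow (f x + t • g x) (by linarith : 1 < p)).comp_hasDerivAt t h1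
    exact h2.congr_deriv (mul_assoc _ _ _)

/-- Clarkson's inequality, pointwise: the parallelogram law combined with superadditivity and
convexity of `s ↦ s^(p/2)`, both valid as `p / 2 ≥ 1`. -/
theorem norm_midpoint_rpow_add_le (hp : 2 ≤ p) (a b : F) :
    ‖(1 / 2 : ℝ) • (a + b)‖ ^ p + ‖(1 / 2 : ℝ) • (a - b)‖ ^ p ≤ (‖a‖ ^ p + ‖b‖ ^ p) / 2 := by
  have hq : 1 ≤ p / 2 := by linarith
  have hsq : ∀ {x : ℝ}, 0 ≤ x → x ^ p = (x ^ 2) ^ (p / 2) := fun {x} hx => by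
    rw [← Real.rpow_natCast x 2, ← Real.rpow_mul hx]
    congr 1
    push_cast
    ring
  have hpar : ‖(1 / 2 : ℝ) • (a + b)‖ ^ 2 + ‖(1 / 2 : ℝ) • (a - b)‖ ^ 2 =
      1 / 2 * ‖a‖ ^ 2 + 1 / 2 * ‖b‖ ^ 2 := by
    rw [norm_smul, norm_smul, mul_pow, mul_pow, norm_add_sq_real, norm_sub_sq_real]
    norm_num
    ring
  rw [hsq (norm_nonneg _), hsq (norm_nonneg _), hsq (norm_nonneg a), hsq (norm_nonneg b)]
  refine (Real.add_rpow_le_rpow_add (by positivity) (by positivity) hq).trans ?_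
  rw [hpar]
  have h := (convexOn_rpow hq).2 (Set.mem_Ici.2 (sq_nonneg ‖a‖)) (Set.mem_Ici.2 (sq_nonneg ‖b‖))
    (by norm_num : (0 : ℝ) ≤ 1 / 2) (by norm_num : (0 : ℝ) ≤ 1 / 2) (by norm_num)
  simp only [smul_eq_mul] at h
  linarith

end NormPow

/-! ### Passing between `L^p` convergence and integrals. -/

section LpNorm

variable {X : Type*} [MeasurableSpace X] {μ : Measure X} {F : Type*} [NormedAddCommGroup F]
  {p : ℝ}

theorem norm_toLp_rpow (hp : 0 < p) {f : X → F} (hf : MemLp f (ENNReal.ofReal p) μ) :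
    ‖hf.toLp f‖ ^ p = ∫ x, ‖f x‖ ^ p ∂μ := by
  have hnn : 0 ≤ ∫ x, ‖f x‖ ^ p ∂μ := integral_nonneg fun x => by positivity
  rw [Lp.norm_toLp, hf.eLpNorm_eq_integral_rpow_norm (by simpa using hp) ENNReal.ofReal_ne_top,
    ENNReal.toReal_ofReal hp.le, ENNReal.toReal_ofReal (by positivity), ← Real.rpow_mul hnn,
    inv_mul_cancel₀ hp.ne', Real.rpow_one]

theorem tendsto_integral_norm_rpow (hp : 1 ≤ p) {ι : Type*} {l : Filter ι} {f : ι → X → F}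
    {f₀ : X → F} (hf : ∀ i, MemLp (f i) (ENNReal.ofReal p) μ)
    (hf₀ : MemLp f₀ (ENNReal.ofReal p) μ)
    (h : Tendsto (fun i => eLpNorm (f i - f₀) (ENNReal.ofReal p) μ) l (𝓝 0)) :
    Tendsto (fun i => ∫ x, ‖f i x‖ ^ p ∂μ) l (𝓝 (∫ x, ‖f₀ x‖ ^ p ∂μ)) := by
  have hp0 : 0 < p := by linarith
  have : Fact (1 ≤ ENNReal.ofReal p) := ⟨by simpa using ENNReal.ofReal_le_ofReal hp⟩
  have h1 := (Lp.tendsto_Lp_iff_tendsto_eLpNorm'' f hf f₀ hf₀).2 h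
  simpa only [norm_toLp_rpow hp0] using h1.norm.rpow_const (p := p) (Or.inr hp0.le)

theorem exists_tendsto_eLpNorm_of_cauchySeq_toLp {P : ENNReal} [Fact (1 ≤ P)] [CompleteSpace F]
    {f : ℕ → X → F} (hf : ∀ n, MemLp (f n) P μ) (h : CauchySeq fun n => (hf n).toLp (f n)) :
    ∃ g : X → F, MemLp g P μ ∧ Tendsto (fun n => eLpNorm (f n - g) P μ) atTop (𝓝 0) := by
  obtain ⟨g, hg⟩ := cauchySeq_tendsto_of_complete h
  refine ⟨g, Lp.memLp g, (Lp.tendsto_Lp_iff_tendsto_eLpNorm'' f hf g (Lp.memLp g)).1 ?_⟩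
  rwa [Lp.toLp_coeFn]

theorem integral_norm_rpow_eq_zero_iff (hp : 0 < p) {f : X → F}
    (hf : MemLp f (ENNReal.ofReal p) μ) : ∫ x, ‖f x‖ ^ p ∂μ = 0 ↔ f =ᵐ[μ] 0 := by
  rw [integral_eq_zero_iff_of_nonneg (fun x => by positivity)
    (hf.integrable_norm_rpow_of_ofReal hp)]
  refine eventually_congr (Eventually.of_forall fun x => ?_)
  simp [Real.rpow_eq_zero (norm_nonneg _) hp.ne']

theorem tendsto_eLpNorm_sub_of_bounded [IsFiniteMeasure μ] (hp : 0 < p) {f : ℕ → X → F}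
    {f₀ : X → F} {M : ℝ} (hf : ∀ n, AEStronglyMeasurable (f n) μ) (hM : ∀ n x, ‖f n x‖ ≤ M)
    (h : ∀ x, Tendsto (fun n => f n x) atTop (𝓝 (f₀ x))) :
    Tendsto (fun n => eLpNorm (f n - f₀) (ENNReal.ofReal p) μ) atTop (𝓝 0) := by
  have hf₀ : AEStronglyMeasurable f₀ μ :=
    aestronglyMeasurable_of_tendsto_ae _ hf (Eventually.of_forall h)
  have hM₀ : ∀ x, ‖f₀ x‖ ≤ M := fun x => le_of_tendsto' (h x).norm fun n => hM n x
  simp only [eLpNorm_ofReal_eq_lintegral hp]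
  have key : Tendsto (fun n => ∫⁻ x, ‖(f n - f₀) x‖ₑ ^ p ∂μ) atTop (𝓝 (∫⁻ _, 0 ∂μ)) := by
    refine tendsto_lintegral_of_dominated_convergence' (fun _ => ENNReal.ofReal (M + M) ^ p)
      (fun n => ((hf n).sub hf₀).enorm.pow_const p) (fun n => Eventually.of_forall fun x => ?_)
      ?_ (Eventually.of_forall fun x => ?_)
    · refine ENNReal.rpow_le_rpow ?_ hp.le
      rw [← ofReal_norm]
      exact ENNReal.ofReal_le_ofReal ((norm_sub_le _ _).trans (add_le_add (hM n x) (hM₀ x)))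
    · simp [ENNReal.mul_eq_top, measure_ne_top, hp.le]
    · have h1 : Tendsto (fun n => ‖f n x - f₀ x‖ₑ) atTop (𝓝 0) := by
        have := ((h x).sub_const (f₀ x)).enorm
        simpa using this
      simpa [hp] using h1.ennrpow_const p
  simpa [hp] using key.ennrpow_const (1 / p)

end LpNorm

/-! ### Compactness of the embedding into `L^p`. -/

section Compactness

variable {N : ℕ} {Ω : Set (EuclideanSpace ℝ (Fin N))} {p : ℝ}

/-- Sequential Banach–Alaoglu in `L²` through the Riesz isometry, evaluated at indicators. Only
convergence of integrals over sets, in particular balls, is needed. -/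
theorem exists_subseq_tendsto_setIntegral {f : ℕ → EuclideanSpace ℝ (Fin N) → ℝ}
    (hf : ∀ n, MemLp (f n) 2 volume) {A : NNReal} (hA : ∀ n, eLpNorm (f n) 2 volume ≤ A) :
    ∃ θ : ℕ → ℕ, StrictMono θ ∧ ∀ S : Set (EuclideanSpace ℝ (Fin N)), MeasurableSet S →
      volume S ≠ ⊤ → ∃ l : ℝ, Tendsto (fun n => ∫ x in S, f (θ n) x) atTop (𝓝 l) := by
  let H := Lp ℝ 2 (volume : Measure (EuclideanSpace ℝ (Fin N)))
  let T : ℕ → WeakDual ℝ H := fun n =>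
    WeakDual.toStrongDual.symm (InnerProductSpace.toDual ℝ H ((hf n).toLp (f n)))
  have hT : ∀ n, T n ∈ WeakDual.toStrongDual ⁻¹' Metric.closedBall (0 : StrongDual ℝ H) A := by
    intro n
    simp only [T, Set.mem_preimage, LinearEquiv.apply_symm_apply, mem_closedBall_zero_iff,
      LinearIsometryEquiv.norm_map]
    rw [Lp.norm_toLp]
    exact ENNReal.toReal_le_coe_of_le_coe (hA n)
  have : Fact ((2 : ENNReal) ≠ ⊤) := ⟨by simp⟩
  obtain ⟨Λ, -, θ, hθ, hlim⟩ := WeakDual.isSeqCompact_closedBall ℝ H 0 A hT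
  refine ⟨θ, hθ, fun S hS hSv => ⟨Λ (indicatorConstLp 2 hS hSv 1), ?_⟩⟩
  have h1 := ((WeakDual.eval_continuous (𝕜 := ℝ)
    (indicatorConstLp 2 hS hSv (1 : ℝ) : H)).tendsto Λ).comp hlim
  refine h1.congr fun n => ?_
  have h2 : T (θ n) (indicatorConstLp 2 hS hSv 1) =
      inner ℝ ((hf (θ n)).toLp (f (θ n))) (indicatorConstLp 2 hS hSv (1 : ℝ) : H) := rfl
  simp only [Function.comp_apply]
  rw [h2, real_inner_comm, L2.inner_indicatorConstLp_one]
  exact integral_congr_ae (ae_restrict_of_ae (hf (θ n)).coeFn_toLp)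

theorem integral_cond_ball_add_eq (f : EuclideanSpace ℝ (Fin N) → ℝ) (r : ℝ)
    (x : EuclideanSpace ℝ (Fin N)) :
    ∫ h, f (x + h) ∂(ProbabilityTheory.cond volume (Metric.ball 0 r)) =
      (volume (Metric.ball (0 : EuclideanSpace ℝ (Fin N)) r)).toReal⁻¹ *
        ∫ y in Metric.ball x r, f y := by
  rw [ProbabilityTheory.cond, integral_smul_measure, ENNReal.toReal_inv, smul_eq_mul]
  congr 1
  have h1 := (measurePreserving_add_left (volume : Measure (EuclideanSpace ℝ (Fin N))) x
    ).setIntegral_preimage_emb (measurableEmbedding_addLeft x) f (Metric.ball x r)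
  rw [← h1]
  congr 2
  ext y
  simp

/-- **Rellich–Kondrachov**, for sequences of test functions and `2 ≤ p`. -/
theorem exists_subseq_tendsto_of_bounded_gradient (hΩb : Bornology.IsBounded Ω) (hp : 2 ≤ p)
    {f : ℕ → EuclideanSpace ℝ (Fin N) → ℝ} (hf : ∀ n, IsTestFunction Ω (f n)) {A B : NNReal}
    (hA : ∀ n, eLpNorm (f n) (ENNReal.ofReal p) (volume.restrict Ω) ≤ A)
    (hB : ∀ n, eLpNorm (gradient (f n)) (ENNReal.ofReal p) (volume.restrict Ω) ≤ B) :
    ∃ θ : ℕ → ℕ, StrictMono θ ∧ ∃ w : EuclideanSpace ℝ (Fin N) → ℝ,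
      MemLp w (ENNReal.ofReal p) (volume.restrict Ω) ∧
      Tendsto (fun n => eLpNorm (f (θ n) - w) (ENNReal.ofReal p) (volume.restrict Ω))
        atTop (𝓝 0) := by
  have hp1 : 1 ≤ p := by linarith
  have hp0 : 0 < p := by linarith
  have hP2 : 2 ≤ ENNReal.ofReal p := by simpa using ENNReal.ofReal_le_ofReal hp
  have hP : 1 ≤ ENNReal.ofReal p := one_le_two.trans hP2
  have : Fact (1 ≤ ENNReal.ofReal p) := ⟨hP⟩
  have hfin : IsFiniteMeasure (volume.restrict Ω) := ⟨by simpa using hΩb.measure_lt_top⟩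
  -- The `L²` bound feeds weak compactness; the `L¹` bound makes the ball averages uniformly
  -- bounded.
  have hlow : ∀ s : ENNReal, 1 ≤ s → s ≤ ENNReal.ofReal p →
      ∃ C : NNReal, ∀ n, eLpNorm (f n) s volume ≤ C := by
    intro s hs hsp
    have hst : s ≠ ⊤ := (hsp.trans_lt ENNReal.ofReal_lt_top).ne
    have hfac : volume.restrict Ω Set.univ ^ (1 / s.toReal - 1 / (ENNReal.ofReal p).toReal) ≠ ⊤ := by
      refine ENNReal.rpow_ne_top_of_nonneg (sub_nonneg.2 ?_) (measure_ne_top _ _)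
      have h1 : 1 ≤ s.toReal := by simpa using ENNReal.toReal_mono hst hs
      exact one_div_le_one_div_of_le (by linarith) (ENNReal.toReal_mono ENNReal.ofReal_ne_top hsp)
    refine ⟨(A * volume.restrict Ω Set.univ ^
      (1 / s.toReal - 1 / (ENNReal.ofReal p).toReal)).toNNReal, fun n => ?_⟩
    rw [ENNReal.coe_toNNReal (ENNReal.mul_ne_top ENNReal.coe_ne_top hfac),
      ← (hf n).eLpNorm_restrict]
    refine (eLpNorm_le_eLpNorm_mul_rpow_measure_univ hsp
      (hf n).continuous.aestronglyMeasurable).trans ?_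
    gcongr
    exact hA n
  obtain ⟨A₂, hA₂⟩ := hlow 2 one_le_two hP2
  obtain ⟨A₁, hA₁⟩ := hlow 1 le_rfl hP
  obtain ⟨θ, hθ, hlim⟩ := exists_subseq_tendsto_setIntegral (fun n => (hf n).memLp 2) hA₂
  have hmem : ∀ n, MemLp (f (θ n)) (ENNReal.ofReal p) (volume.restrict Ω) :=
    fun n => ((hf _).memLp _).restrict Ω
  have hcauchy : CauchySeq fun n => (hmem n).toLp (f (θ n)) := by
    rw [EMetric.cauchySeq_iff]
    intro ε hε
    have hε4 : 0 < ε / 4 := ENNReal.div_pos hε.ne' (by simp)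
    obtain ⟨δ, hδ0, hδ⟩ := ENNReal.lt_iff_exists_nnreal_btwn.1 hε4
    have hδ0' : 0 < δ := by exact_mod_cast hδ0
    -- Chosen so that `r * B ≤ δ < ε / 4`; the `+ 1` covers `B = 0`.
    let r : ℝ := δ / (B + 1)
    have hr : 0 < r := by positivity
    have hrB : ENNReal.ofReal r * B ≤ δ := by
      rw [← ENNReal.ofReal_coe_nnreal, ← ENNReal.ofReal_coe_nnreal (p := δ),
        ← ENNReal.ofReal_mul hr.le]
      refine ENNReal.ofReal_le_ofReal ?_
      simp only [r]
      rw [div_mul_eq_mul_div, div_le_iff₀ (by positivity)]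
      have : (0 : ℝ) ≤ δ := δ.2
      nlinarith
    have hball0 : volume (Metric.ball (0 : EuclideanSpace ℝ (Fin N)) r) ≠ 0 :=
      (Metric.measure_ball_pos _ _ hr).ne'
    let ν := ProbabilityTheory.cond (volume : Measure (EuclideanSpace ℝ (Fin N)))
      (Metric.ball 0 r)
    have hνp : IsProbabilityMeasure ν :=
      ProbabilityTheory.cond_isProbabilityMeasure_of_finite hball0 measure_ball_lt_top.ne
    have hν : ∀ᵐ h ∂ν, ‖h‖ ≤ r := by
      refine Measure.ae_smul_measure ?_ _
      filter_upwards [ae_restrict_mem Metric.isOpen_ball.measurableSet] with h hh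
      simpa using (Metric.mem_ball.1 hh).le
    -- At fixed radius these averages are uniformly bounded and converge at every point, hence
    -- converge in `L^p` by dominated convergence.
    let a : ℕ → EuclideanSpace ℝ (Fin N) → ℝ := fun n x => ∫ h, f (θ n) (x + h) ∂ν
    have ha_meas : ∀ n, AEStronglyMeasurable (a n) (volume.restrict Ω) := fun n => by
      have hc : Continuous fun z : EuclideanSpace ℝ (Fin N) × EuclideanSpace ℝ (Fin N) =>
        f (θ n) (z.1 + z.2) := (hf (θ n)).continuous.comp (by fun_prop)
      exact (hc.stronglyMeasurable.integral_prod_right' (ν := ν)).aestronglyMeasurable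
    have ha_bound : ∀ n x, ‖a n x‖ ≤
        (volume (Metric.ball (0 : EuclideanSpace ℝ (Fin N)) r)).toReal⁻¹ * A₁ := by
      intro n x
      simp only [a, ν, integral_cond_ball_add_eq]
      rw [norm_mul, Real.norm_of_nonneg (by positivity)]
      gcongr
      refine (ENNReal.ofReal_le_ofReal_iff A₁.2).1 ?_
      rw [ofReal_norm]
      refine (enorm_integral_le_lintegral_enorm _).trans
        ((setLIntegral_le_lintegral _ _).trans ?_)
      rw [← eLpNorm_one_eq_lintegral_enorm]
      exact (hA₁ _).trans_eq (ENNReal.ofReal_coe_nnreal).symm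
    have ha_lim : ∀ x, ∃ l, Tendsto (fun n => a n x) atTop (𝓝 l) := fun x => by
      obtain ⟨l, hl⟩ := hlim (Metric.ball x r) Metric.isOpen_ball.measurableSet
        measure_ball_lt_top.ne
      exact ⟨_, by simpa only [a, ν, integral_cond_ball_add_eq] using hl.const_mul _⟩
    choose a₀ ha₀ using ha_lim
    have ha₀_meas : AEStronglyMeasurable a₀ (volume.restrict Ω) :=
      aestronglyMeasurable_of_tendsto_ae _ ha_meas (Eventually.of_forall ha₀)
    have ha_tendsto := tendsto_eLpNorm_sub_of_bounded hp0 ha_meas ha_bound ha₀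
    obtain ⟨M, hM⟩ := eventually_atTop.1 (ha_tendsto.eventually_lt_const hε4)
    have hfa : ∀ n, eLpNorm (f (θ n) - a n) (ENNReal.ofReal p) (volume.restrict Ω) < ε / 4 := by
      intro n
      refine lt_of_le_of_lt ?_ hδ
      refine (eLpNorm_mono_measure _ Measure.restrict_le_self).trans ?_
      refine ((hf (θ n)).eLpNorm_sub_average_le hp1 hν).trans (le_trans ?_ hrB)
      rw [← (hf (θ n)).eLpNorm_gradient_restrict]
      gcongr
      exact hB _
    have hfa₀ : ∀ n ≥ M, eLpNorm (f (θ n) - a₀) (ENNReal.ofReal p) (volume.restrict Ω) <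
        ε / 4 + ε / 4 := by
      intro n hn
      rw [← sub_add_sub_cancel (f (θ n)) (a n) a₀]
      exact (eLpNorm_add_le ((hmem n).1.sub (ha_meas n)) ((ha_meas n).sub ha₀_meas) hP).trans_lt
        (ENNReal.add_lt_add (hfa n) (hM n hn))
    refine ⟨M, fun m hm n hn => ?_⟩
    -- Four errors below `ε / 4`: function to average and average to limit, for each of `m` and `n`.
    rw [Lp.edist_toLp_toLp, ← sub_add_sub_cancel (f (θ m)) a₀ (f (θ n))]
    refine (eLpNorm_add_le ((hmem m).1.sub ha₀_meas) (ha₀_meas.sub (hmem n).1) hP).trans_lt ?_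
    rw [eLpNorm_sub_comm a₀]
    refine (ENNReal.add_lt_add (hfa₀ m hm) (hfa₀ n hn)).trans_eq ?_
    rw [← two_mul, ← two_mul, ← mul_assoc]
    norm_num
    exact ENNReal.mul_div_cancel (by simp) (by simp)
  exact ⟨θ, hθ, exists_tendsto_eLpNorm_of_cauchySeq_toLp hmem hcauchy⟩

end Compactness

/-! ### Existence of a Rayleigh minimizer and its Euler–Lagrange equation. -/

section Minimizer

theorem integral_norm_const_smul_rpow {X : Type*} [MeasurableSpace X] (μ : Measure X) {F : Type*}
    [NormedAddCommGroup F] [NormedSpace ℝ F] (p c : ℝ) (f : X → F) :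
    ∫ x, ‖(c • f) x‖ ^ p ∂μ = |c| ^ p * ∫ x, ‖f x‖ ^ p ∂μ := by
  rw [← integral_const_mul]
  congr 1
  ext x
  rw [Pi.smul_apply, norm_smul, Real.norm_eq_abs, Real.mul_rpow (abs_nonneg _) (norm_nonneg _)]

variable {N : ℕ} {Ω : Set (EuclideanSpace ℝ (Fin N))} {p : ℝ}

/-- The energies `∫_Ω |∇φ|^p` of the test functions with `∫_Ω |φ|^p = 1`. -/
def normalizedEnergies {N : ℕ} (Ω : Set (EuclideanSpace ℝ (Fin N))) (p : ℝ) : Set ℝ :=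
  {r | ∃ φ : EuclideanSpace ℝ (Fin N) → ℝ, IsTestFunction Ω φ ∧ ∫ x in Ω, ‖φ x‖ ^ p = 1 ∧
    r = ∫ x in Ω, ‖gradient φ x‖ ^ p}

theorem bddBelow_normalizedEnergies : BddBelow (normalizedEnergies Ω p) := by
  refine ⟨0, ?_⟩
  rintro r ⟨φ, -, -, rfl⟩
  exact integral_nonneg fun x => by positivity

theorem IsTestFunction.div_mem_normalizedEnergies (hp : 0 < p)
    {φ : EuclideanSpace ℝ (Fin N) → ℝ} (hφ : IsTestFunction Ω φ)
    (h : 0 < ∫ x in Ω, ‖φ x‖ ^ p) :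
    (∫ x in Ω, ‖gradient φ x‖ ^ p) / ∫ x in Ω, ‖φ x‖ ^ p ∈ normalizedEnergies Ω p := by
  set I := ∫ x in Ω, ‖φ x‖ ^ p
  have hc : |I⁻¹ ^ (1 / p)| ^ p = I⁻¹ := by
    rw [abs_of_nonneg (by positivity), ← Real.rpow_mul (by positivity),
      one_div_mul_cancel hp.ne', Real.rpow_one]
  refine ⟨I⁻¹ ^ (1 / p) • φ, hφ.const_smul _, ?_, ?_⟩
  · rw [integral_norm_const_smul_rpow, hc]
    exact inv_mul_cancel₀ h.ne'
  · rw [hφ.gradient_const_smul, integral_norm_const_smul_rpow, hc, div_eq_inv_mul]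

theorem HasSobolevGradientZero.sInf_mul_integral_le (hp : 1 ≤ p)
    {z : EuclideanSpace ℝ (Fin N) → ℝ} {Z : EuclideanSpace ℝ (Fin N) → EuclideanSpace ℝ (Fin N)}
    (hz : HasSobolevGradientZero Ω p z Z) :
    sInf (normalizedEnergies Ω p) * ∫ x in Ω, ‖z x‖ ^ p ≤ ∫ x in Ω, ‖Z x‖ ^ p := by
  have hp0 : 0 < p := by linarith
  obtain ⟨φ, hφ, h1, h2⟩ := hz.approx
  have t1 := tendsto_integral_norm_rpow hp (fun n => ((hφ n).memLp _).restrict Ω) hz.memLp h1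
  have t2 := tendsto_integral_norm_rpow hp (fun n => ((hφ n).memLp_gradient _).restrict Ω)
    hz.memLp_grad h2
  refine le_of_tendsto_of_tendsto' (t1.const_mul _) t2 fun n => ?_
  have hnn : 0 ≤ ∫ x in Ω, ‖φ n x‖ ^ p := integral_nonneg fun x => by positivity
  rcases hnn.eq_or_lt with h0 | h0
  · rw [← h0, mul_zero]
    exact integral_nonneg fun x => by positivity
  · rw [← le_div_iff₀ h0]
    exact csInf_le bddBelow_normalizedEnergies ((hφ n).div_mem_normalizedEnergies hp0 h0)

theorem HasSobolevGradientZero.normalizedEnergies_nonempty (hp : 1 ≤ p)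
    {z : EuclideanSpace ℝ (Fin N) → ℝ} {Z : EuclideanSpace ℝ (Fin N) → EuclideanSpace ℝ (Fin N)}
    (hz : HasSobolevGradientZero Ω p z Z) (hz0 : ¬ z =ᵐ[volume.restrict Ω] 0) :
    (normalizedEnergies Ω p).Nonempty := by
  have hp0 : 0 < p := by linarith
  obtain ⟨φ, hφ, h1, -⟩ := hz.approx
  have t1 := tendsto_integral_norm_rpow hp (fun n => ((hφ n).memLp _).restrict Ω) hz.memLp h1
  have hpos : 0 < ∫ x in Ω, ‖z x‖ ^ p :=
    (integral_nonneg fun x => by positivity).lt_of_ne'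
      (mt (integral_norm_rpow_eq_zero_iff hp0 hz.memLp).1 hz0)
  obtain ⟨n, hn⟩ := (t1.eventually_const_lt hpos).exists
  exact ⟨_, (hφ n).div_mem_normalizedEnergies hp0 hn⟩

/-- Midpoints of far terms have `L^p` norm near `1`, hence energy nearly at least the infimum.
Clarkson's inequality then leaves no room for the gradient differences. -/
theorem cauchySeq_gradient_of_tendsto_sInf (hΩb : Bornology.IsBounded Ω) (hp : 2 ≤ p)
    [Fact (1 ≤ ENNReal.ofReal p)] {φ : ℕ → EuclideanSpace ℝ (Fin N) → ℝ}
    (hφ : ∀ n, IsTestFunction Ω (φ n)) {w : EuclideanSpace ℝ (Fin N) → ℝ}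
    (hw : MemLp w (ENNReal.ofReal p) (volume.restrict Ω)) (hw1 : ∫ x in Ω, ‖w x‖ ^ p = 1)
    (hφw : Tendsto (fun n => eLpNorm (φ n - w) (ENNReal.ofReal p) (volume.restrict Ω))
      atTop (𝓝 0))
    (hE : Tendsto (fun n => ∫ x in Ω, ‖gradient (φ n) x‖ ^ p) atTop
      (𝓝 (sInf (normalizedEnergies Ω p)))) :
    CauchySeq fun n => (((hφ n).memLp_gradient (ENNReal.ofReal p)).restrict Ω).toLp
      (gradient (φ n)) := by
  have hp1 : 1 ≤ p := by linarith
  have hp0 : 0 < p := by linarith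
  set m := sInf (normalizedEnergies Ω p)
  have hmem := fun n => ((hφ n).memLp (ENNReal.ofReal p)).restrict Ω
  have hgmem := fun n => ((hφ n).memLp_gradient (ENNReal.ofReal p)).restrict Ω
  have hψ : ∀ k : ℕ × ℕ, IsTestFunction Ω ((1 / 2 : ℝ) • (φ k.1 + φ k.2)) :=
    fun k => ((hφ k.1).add (hφ k.2)).const_smul _
  have hfst : Tendsto (Prod.fst : ℕ × ℕ → ℕ) atTop atTop := by
    rw [← prod_atTop_atTop_eq]; exact tendsto_fst
  have hsnd : Tendsto (Prod.snd : ℕ × ℕ → ℕ) atTop atTop := by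
    rw [← prod_atTop_atTop_eq]; exact tendsto_snd
  have hψw : Tendsto (fun k : ℕ × ℕ => ∫ x in Ω, ‖((1 / 2 : ℝ) • (φ k.1 + φ k.2)) x‖ ^ p)
      atTop (𝓝 1) := by
    have h1 := (Lp.tendsto_Lp_iff_tendsto_eLpNorm'' φ hmem w hw).2 hφw
    have h2 := (((h1.comp hfst).add (h1.comp hsnd)).const_smul (1 / 2 : ℝ)).norm.rpow_const
      (p := p) (Or.inr hp0.le)
    rw [← two_smul ℝ, smul_smul, one_div_mul_cancel two_ne_zero, one_smul,
      norm_toLp_rpow hp0, hw1] at h2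
    refine h2.congr fun k => ?_
    simp only [Function.comp_apply]
    rw [← MemLp.toLp_add, ← MemLp.toLp_const_smul, norm_toLp_rpow hp0]
  have hle : ∀ k : ℕ × ℕ, ∫ x in Ω, ‖((1 / 2 : ℝ) • (gradient (φ k.1) - gradient (φ k.2))) x‖ ^ p ≤
      ((∫ x in Ω, ‖gradient (φ k.1) x‖ ^ p) + ∫ x in Ω, ‖gradient (φ k.2) x‖ ^ p) / 2 -
        m * ∫ x in Ω, ‖((1 / 2 : ℝ) • (φ k.1 + φ k.2)) x‖ ^ p := by
    intro k
    have h1 := (HasSobolevGradientZero.of_isTestFunction hΩb hp1 (hψ k)).sInf_mul_integral_le hp1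
    rw [((hφ k.1).add (hφ k.2)).gradient_const_smul, (hφ k.1).gradient_add (hφ k.2)] at h1
    have i1 := (((hgmem k.1).add (hgmem k.2)).const_smul (1 / 2 : ℝ)
      ).integrable_norm_rpow_of_ofReal hp0
    have i2 := (((hgmem k.1).sub (hgmem k.2)).const_smul (1 / 2 : ℝ)
      ).integrable_norm_rpow_of_ofReal hp0
    have i3 := (hgmem k.1).integrable_norm_rpow_of_ofReal hp0
    have i4 := (hgmem k.2).integrable_norm_rpow_of_ofReal hp0
    have h2 := integral_mono (i1.add i2) ((i3.add i4).div_const 2)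
      fun x => norm_midpoint_rpow_add_le hp (gradient (φ k.1) x) (gradient (φ k.2) x)
    simp only [Pi.add_apply] at h2
    rw [integral_add i1 i2, integral_div, integral_add i3 i4] at h2
    linarith
  have hlim : Tendsto (fun k : ℕ × ℕ =>
      ∫ x in Ω, ‖((1 / 2 : ℝ) • (gradient (φ k.1) - gradient (φ k.2))) x‖ ^ p) atTop (𝓝 0) := by
    refine tendsto_of_tendsto_of_tendsto_of_le_of_le tendsto_const_nhds ?_
      (fun k => integral_nonneg fun x => by positivity) hle
    have := (((hE.comp hfst).add (hE.comp hsnd)).div_const 2).sub (hψw.const_mul m)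
    simpa using this
  rw [cauchySeq_iff_tendsto_dist_atTop_0]
  have h3 := (hlim.rpow_const (p := 1 / p) (Or.inr (by positivity))).const_mul 2
  rw [Real.zero_rpow (by positivity), mul_zero] at h3
  refine h3.congr fun k => ?_
  have h4 := norm_toLp_rpow hp0 (((hgmem k.1).sub (hgmem k.2)).const_smul (1 / 2 : ℝ))
  rw [← h4, ← Real.rpow_mul (norm_nonneg _), mul_one_div_cancel hp0.ne', Real.rpow_one,
    MemLp.toLp_const_smul (1 / 2 : ℝ) ((hgmem k.1).sub (hgmem k.2)),
    MemLp.toLp_sub (hgmem k.1) (hgmem k.2), norm_smul, dist_eq_norm,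
    Real.norm_of_nonneg (by norm_num)]
  ring

/-- The given nonzero `z` only ensures that the infimum is over a nonempty set. The infimum is
positive because it is attained, and a zero gradient would force `w = 0`. -/
theorem exists_rayleigh_minimizer (hN : 0 < N) (hΩb : Bornology.IsBounded Ω) (hp : 2 ≤ p)
    {z : EuclideanSpace ℝ (Fin N) → ℝ} {Z : EuclideanSpace ℝ (Fin N) → EuclideanSpace ℝ (Fin N)}
    (hz : HasSobolevGradientZero Ω p z Z) (hz0 : ¬ z =ᵐ[volume.restrict Ω] 0) :
    ∃ (m : ℝ) (w : EuclideanSpace ℝ (Fin N) → ℝ)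
      (W : EuclideanSpace ℝ (Fin N) → EuclideanSpace ℝ (Fin N)), 0 < m ∧
      HasSobolevGradientZero Ω p w W ∧ ¬ w =ᵐ[volume.restrict Ω] 0 ∧
      ∫ x in Ω, ‖W x‖ ^ p = m * ∫ x in Ω, ‖w x‖ ^ p ∧
      ∀ (z : EuclideanSpace ℝ (Fin N) → ℝ)
        (Z : EuclideanSpace ℝ (Fin N) → EuclideanSpace ℝ (Fin N)),
        HasSobolevGradientZero Ω p z Z →
        m * ∫ x in Ω, ‖z x‖ ^ p ≤ ∫ x in Ω, ‖Z x‖ ^ p := by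
  have hp1 : 1 ≤ p := by linarith
  have hp0 : 0 < p := by linarith
  have : Fact (1 ≤ ENNReal.ofReal p) := ⟨by simpa using ENNReal.ofReal_le_ofReal hp1⟩
  obtain ⟨r, -, hr, hrS⟩ := exists_seq_tendsto_sInf (hz.normalizedEnergies_nonempty hp1 hz0)
    bddBelow_normalizedEnergies
  choose φ hφ hφ1 hφE using hrS
  obtain rfl : r = fun n => ∫ x in Ω, ‖gradient (φ n) x‖ ^ p := funext hφE
  have hmem := fun n => ((hφ n).memLp (ENNReal.ofReal p)).restrict Ω
  have hgmem := fun n => ((hφ n).memLp_gradient (ENNReal.ofReal p)).restrict Ω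
  obtain ⟨b, hb⟩ := hr.bddAbove_range
  have hconv : ∀ {F : Type} [NormedAddCommGroup F] {g : EuclideanSpace ℝ (Fin N) → F}
      (hg : MemLp g (ENNReal.ofReal p) (volume.restrict Ω)),
      eLpNorm g (ENNReal.ofReal p) (volume.restrict Ω) =
        ENNReal.ofReal ((∫ x in Ω, ‖g x‖ ^ p) ^ p⁻¹) := fun hg => by
    rw [hg.eLpNorm_eq_integral_rpow_norm (by simpa using hp0) ENNReal.ofReal_ne_top,
      ENNReal.toReal_ofReal hp0.le]
  obtain ⟨θ, hθ, w, hw, hφw⟩ := exists_subseq_tendsto_of_bounded_gradient hΩb hp hφ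
    (A := 1) (B := (b ^ p⁻¹).toNNReal)
    (fun n => by rw [hconv (hmem n), hφ1 n]; simp)
    (fun n => by
      rw [hconv (hgmem n)]
      refine ENNReal.ofReal_le_ofReal (Real.rpow_le_rpow
        (integral_nonneg fun x => by positivity) (hb (Set.mem_range_self n)) (by positivity)))
  have hw1 : ∫ x in Ω, ‖w x‖ ^ p = 1 := by
    refine tendsto_nhds_unique (tendsto_integral_norm_rpow hp1 (fun n => hmem (θ n)) hw hφw) ?_
    simp only [hφ1]
    exact tendsto_const_nhds
  have hE := hr.comp hθ.tendsto_atTop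
  obtain ⟨W, hWmem, hφW⟩ := exists_tendsto_eLpNorm_of_cauchySeq_toLp (fun n => hgmem (θ n))
    (cauchySeq_gradient_of_tendsto_sInf hΩb hp (fun n => hφ (θ n)) hw hw1 hφw hE)
  have hwW : HasSobolevGradientZero Ω p w W :=
    .of_tendsto hΩb hp1 hw hWmem (fun n => hφ (θ n)) hφw hφW
  have hWE : ∫ x in Ω, ‖W x‖ ^ p = sInf (normalizedEnergies Ω p) :=
    tendsto_nhds_unique
      (tendsto_integral_norm_rpow hp1 (fun n => hgmem (θ n)) hWmem hφW) hE
  have hw0 : ¬ w =ᵐ[volume.restrict Ω] 0 := fun h => by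
    rw [(integral_norm_rpow_eq_zero_iff hp0 hw).2 h] at hw1
    exact zero_ne_one hw1
  refine ⟨sInf (normalizedEnergies Ω p), w, W, ?_, hwW, hw0, by rw [hWE, hw1, mul_one],
    fun z Z hz => hz.sInf_mul_integral_le hp1⟩
  rw [← hWE]
  refine (integral_nonneg fun x => by positivity).lt_of_ne' fun h => hw0 ?_
  exact hwW.ae_eq_zero_of_gradient hN hΩb hp1
    ((integral_norm_rpow_eq_zero_iff hp0 hWmem).1 h)

theorem isPLaplaceSolution_of_rayleigh_minimizer (hΩb : Bornology.IsBounded Ω) (hp : 2 ≤ p)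
    {m : ℝ} {w : EuclideanSpace ℝ (Fin N) → ℝ}
    {W : EuclideanSpace ℝ (Fin N) → EuclideanSpace ℝ (Fin N)}
    (hw : HasSobolevGradientZero Ω p w W)
    (hE : ∫ x in Ω, ‖W x‖ ^ p = m * ∫ x in Ω, ‖w x‖ ^ p)
    (hmin : ∀ (z : EuclideanSpace ℝ (Fin N) → ℝ)
        (Z : EuclideanSpace ℝ (Fin N) → EuclideanSpace ℝ (Fin N)),
        HasSobolevGradientZero Ω p z Z →
        m * ∫ x in Ω, ‖z x‖ ^ p ≤ ∫ x in Ω, ‖Z x‖ ^ p) :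
    IsPLaplaceSolution Ω p m w := by
  have hp1 : 1 ≤ p := by linarith
  refine ⟨W, hw, fun φ Φ hφ => ?_⟩
  have hd := (hasDerivAt_integral_norm_add_smul_rpow hp hw.memLp_grad hφ.memLp_grad).sub
    ((hasDerivAt_integral_norm_add_smul_rpow hp hw.memLp hφ.memLp).const_mul m)
  -- The difference, unlike the quotient, needs no division: it is nonnegative for every `t` and
  -- vanishes at `t = 0`.
  have hlocal : IsLocalMin ((fun t : ℝ => ∫ x in Ω, ‖W x + t • Φ x‖ ^ p) -
      fun t : ℝ => m * ∫ x in Ω, ‖w x + t • φ x‖ ^ p) 0 := by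
    refine Eventually.of_forall fun t => ?_
    have h1 := hmin _ _ (hw.add hΩb hp1 (hφ.const_smul hΩb hp1 t))
    simp only [Pi.add_apply, Pi.smul_apply, Pi.sub_apply, zero_smul, add_zero] at h1 ⊢
    linarith
  have h0 := hlocal.hasDerivAt_eq_zero hd
  have h1 : ∀ x, ‖w x‖ ^ (p - 2) * inner ℝ (w x) (φ x) = |w x| ^ (p - 2) * w x * φ x := fun x => by
    simp only [Real.norm_eq_abs, RCLike.inner_apply, conj_trivial]
    ring
  simp only [h1] at h0
  have h2 : p * ((∫ x in Ω, ‖W x‖ ^ (p - 2) * inner ℝ (W x) (Φ x)) -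
      m * ∫ x in Ω, |w x| ^ (p - 2) * w x * φ x) = 0 := by linarith
  rcases mul_eq_zero.1 h2 with h3 | h3 <;> linarith

end Minimizer

/-! ### The main theorem. -/

theorem theorem3p2 {N : ℕ} (hN : 0 < N) (Ω : Set (EuclideanSpace ℝ (Fin N)))
    (hΩ : IsOpen Ω) (hΩb : Bornology.IsBounded Ω) (p q : ℝ) (hp : 1 < p) (hpq : p = q)
    (α β : ℝ) (hα : 1 ≤ α) (hβ : 1 ≤ β) (hαβ : α / p + β / q = 1)
    (lam : ℝ) (hlam : 0 < lam) (u v : EuclideanSpace ℝ (Fin N) → ℝ)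
    (huv : IsSystemSolution Ω p q α β lam u v) :
    u =ᵐ[volume.restrict Ω] v ∧
    IsPLaplaceSolution Ω p lam u ∧
    (IsFirstSystemEigenvalue Ω p q α β lam → IsFirstPLaplaceEigenvalue Ω p lam) := by
  subst hpq
  have hp0 : 0 < p := by linarith
  have hsum : α + β = p := by
    rwa [← add_div, div_eq_one_iff_eq hp0.ne'] at hαβ
  have hp2 : 2 ≤ p := by linarith
  refine ⟨huv.ae_eq hN hΩb hα hβ hsum hlam.le,
    huv.isPLaplaceSolution hN hΩb hα hβ hsum hlam.le, ?_⟩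
  rintro ⟨⟨-, u₀, v₀, h₀, hu₀, -⟩, hleast⟩
  obtain ⟨U₀, hU₀, hE₀⟩ :=
    (h₀.isPLaplaceSolution hN hΩb hα hβ hsum hlam.le).exists_gradient_integral_eq hp0
  have hne : ∀ {z : EuclideanSpace ℝ (Fin N) → ℝ}
      {Z : EuclideanSpace ℝ (Fin N) → EuclideanSpace ℝ (Fin N)},
      HasSobolevGradientZero Ω p z Z → ¬ z =ᵐ[volume.restrict Ω] 0 →
        0 < ∫ x in Ω, |z x| ^ p := fun hz hz0 =>
    (integral_nonneg fun x => by positivity).lt_of_ne'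
      (mt (integral_norm_rpow_eq_zero_iff hp0 hz.memLp).1 hz0)
  refine ⟨⟨u₀, U₀, hU₀, hu₀, ?_⟩, ?_⟩
  · rw [hE₀, mul_div_cancel_right₀ _ (hne hU₀ hu₀).ne']
  · rintro r ⟨z, Z, hz, hz0, rfl⟩
    -- The quotient of `z` need not be an eigenvalue, so `lam` is compared first with the minimum
    -- `m`, which is one, and then `m` with the quotient of `z`.
    obtain ⟨m, w, W, hm, hw, hw0, hE, hmin⟩ := exists_rayleigh_minimizer hN hΩb hp2 hz hz0
    have hsol := (isPLaplaceSolution_of_rayleigh_minimizer hΩb hp2 hw hE hmin).isSystemSolution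
      hsum
    have hle : lam ≤ m := hleast ⟨hm, w, w, hsol, hw0, hw0⟩
    rw [le_div_iff₀ (hne hz hz0)]
    exact (mul_le_mul_of_nonneg_right hle (hne hz hz0).le).trans (hmin z Z hz)
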